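/- **Crossing criterion.** A *tubular graph of graphs* $X$ consists of a finite connected graph $\Gamma$ (loops and multiple edges allowed), a finite connected simplicial graph $X_s$ for each vertex $s$ of $\Gamma$, a simplicial circle $X_a$ for each edge $a$ of $\Gamma$, and, for each of the two ends of $a$, a simplicial immersion (a locally injective graph morphism) of $X_a$ to the vertex graph at that end. We also denote by $X$ its geometric realisation, the square complex obtained from $\bigsqcup_s X_s$ by gluing the two boundary circles of each tube $X_a\times[0,1]$ along these immersions. Say that $X$ is *Brady–Meier* if each vertex link is connected and remains connected after removing any simplex of the link. Let $X$ be a Brady–Meier tubular graph of graphs and let $\widetilde X$ be its universal cover, with its lifted square complex structure and its $\mathrm{CAT}(0)$ metric, in which every square is a Euclidean unit square. - A *combinatorial line* $L\subset\widetilde X$ is the image of an isometric embedding of graphs from $\mathbb R$, subdivided at the integers, to the $1$-skeleton of $\widetilde X$ which is also an isometric embedding of $\mathbb R$ for the $\mathrm{CAT}(0)$ metric. - For subsets $A, B$ of a space $W$, say that $A$ *separates* $B$ in $W$ if two points of $B\setminus A$ lie in different connected components of $W\setminus A$. The line $L$ is *separating* if it separates $\widetilde X$ in $\widetilde X$. -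 A *half-space* of a separating line $L$ is the closure in $\widetilde X$ of a connected component of $\widetilde X\setminus L$. For separating lines $L,L'$, say that $L$ *crosses* $L'$ if no half-space of $L'$ contains $L$. - For a path $P$ embedded in the $1$-skeleton of $\widetilde X$, the *regular neighbourhood* $N(P)$ is the union of the closed cells that meet $P$ in the second cubical subdivision of $\widetilde X$ (each edge cut into four edges of length $\frac14$, each square into sixteen squares of side $\frac14$). The *regular sphere* $\partial N(P)$ is the union of the closed cells of $N(P)$ (in this subdivision) that are disjoint from $P$. Let $L$ and $L'$ be two separating combinatorial lines in $\widetilde X$, and put $P=L\cap L'$. Then $L$ crosses $L'$ if and only if 1. $P$ is non-empty and compact, and 2. $L'\cap\partial N(P)$ separates $L\cap\partial N(P)$ in $\partial N(P)$. -/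

import Mathlib

/-! ### VH-complexes -/

/-- A `VH`-complex, given combinatorially.

`V` is the set of vertices and `D` the set of oriented edges (half-edges), `src d` being the vertex
at which `d` starts and `inv d` the same edge with the opposite orientation. Every edge is either
vertical or horizontal. `F` is the set of *corners* of squares, so that each square contributes
exactly four elements of `F`. Placing a corner `f` of a square at the origin of `[0,1]²`, `hside f`
is the horizontal side `[0,1] × 0` and `vside f` the vertical side `0 × [0,1]`, both oriented away
from the corner; `flipH f` is the corner at `(1,0)` and `flipV f` is the corner at `(0,1)`. -/
structure VHComplex where
  V : Type*
  D : Type*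
  F : Type*
  src : D → V
  inv : D → D
  inv_inv : ∀ d, inv (inv d) = d
  inv_ne : ∀ d, inv d ≠ d
  vertical : D → Prop
  vertical_inv : ∀ d, vertical (inv d) ↔ vertical d
  vside : F → D
  hside : F → D
  vertical_vside : ∀ f, vertical (vside f)
  horizontal_hside : ∀ f, ¬ vertical (hside f)
  src_vside : ∀ f, src (vside f) = src (hside f)
  flipH : F → F
  flipV : F → F
  flipH_flipH : ∀ f, flipH (flipH f) = f
  flipV_flipV : ∀ f, flipV (flipV f) = f
  flip_comm : ∀ f, flipH (flipV f) = flipV (flipH f)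
  flip_ne : ∀ f, flipH (flipV f) ≠ f
  hside_flipH : ∀ f, hside (flipH f) = inv (hside f)
  vside_flipV : ∀ f, vside (flipV f) = inv (vside f)

namespace VHComplex

/-- The vertex at which an oriented edge ends. -/
def tgt (Z : VHComplex) (d : Z.D) : Z.V := Z.src (Z.inv d)

/-- The link of a vertex: its vertices are the half-edges at `v`, and two of them are joined when
they are the two sides of a square at a corner of that square. -/
def link (Z : VHComplex) (v : Z.V) : SimpleGraph {d : Z.D // Z.src d = v} where
  Adj d e := ∃ f : Z.F, (Z.vside f = d ∧ Z.hside f = e) ∨ (Z.vside f = e ∧ Z.hside f = d)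
  symm := ⟨fun _ _ ⟨f, h⟩ => ⟨f, h.symm⟩⟩
  loopless := ⟨fun d ⟨f, h⟩ => by
    have h' : Z.vside f = d ∧ Z.hside f = d := h.elim id id
    exact Z.horizontal_hside f (by rw [h'.2, ← h'.1]; exact Z.vertical_vside f)⟩

/-- Brady-Meier: every vertex link is connected, and it remains connected after removing any simplex
(a vertex, or an edge together with its endpoints). -/
def IsBradyMeier (Z : VHComplex) : Prop :=
  ∀ v : Z.V, (Z.link v).Connected ∧
    (∀ d, ((Z.link v).induce {d}ᶜ).Connected) ∧
    (∀ d e, (Z.link v).Adj d e → ((Z.link v).induce {d, e}ᶜ).Connected)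

/-! ### Edge paths, homotopy, universal covers -/

/-- `Z.IsWalk v l w`: the list `l` of oriented edges is an edge path from `v` to `w`. -/
inductive IsWalk (Z : VHComplex) : Z.V → List Z.D → Z.V → Prop
  | nil (v : Z.V) : IsWalk Z v [] v
  | cons (d : Z.D) (l : List Z.D) (w : Z.V) :
      IsWalk Z (Z.tgt d) l w → IsWalk Z (Z.src d) (d :: l) w

/-- Elementary moves on edge paths: deleting a backtrack, or replacing two consecutive sides of a
square by the other two sides. -/
inductive ElementaryMove (Z : VHComplex) : List Z.D → List Z.D → Prop
  | backtrack (l₁ l₂ : List Z.D) (d : Z.D) :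
      ElementaryMove Z (l₁ ++ [d, Z.inv d] ++ l₂) (l₁ ++ l₂)
  | square (l₁ l₂ : List Z.D) (f : Z.F) :
      ElementaryMove Z (l₁ ++ [Z.hside f, Z.vside (Z.flipH f)] ++ l₂)
        (l₁ ++ [Z.vside f, Z.hside (Z.flipV f)] ++ l₂)

/-- Homotopy (relative to the endpoints) of edge paths from `v` to `w`. -/
def Homotopic (Z : VHComplex) (v w : Z.V) : List Z.D → List Z.D → Prop :=
  Relation.EqvGen fun l l' => Z.IsWalk v l w ∧ Z.IsWalk v l' w ∧ Z.ElementaryMove l l'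

def IsConnected (Z : VHComplex) : Prop :=
  Nonempty Z.V ∧ ∀ v w : Z.V, ∃ l, Z.IsWalk v l w

/-- Connected, and the edge-path group is trivial. -/
def IsSimplyConnected (Z : VHComplex) : Prop :=
  Z.IsConnected ∧ ∀ (v : Z.V) (l : List Z.D), Z.IsWalk v l v → Z.Homotopic v v l []

/-- A cellular map of `VH`-complexes sending each cell isomorphically to a cell of the same kind. -/
structure Hom (Y X : VHComplex) where
  onV : Y.V → X.V
  onD : Y.D → X.D
  onF : Y.F → X.F
  map_src : ∀ d, onV (Y.src d) = X.src (onD d)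
  map_inv : ∀ d, onD (Y.inv d) = X.inv (onD d)
  map_vertical : ∀ d, X.vertical (onD d) ↔ Y.vertical d
  map_vside : ∀ f, onD (Y.vside f) = X.vside (onF f)
  map_hside : ∀ f, onD (Y.hside f) = X.hside (onF f)
  map_flipH : ∀ f, onF (Y.flipH f) = X.flipH (onF f)
  map_flipV : ∀ f, onF (Y.flipV f) = X.flipV (onF f)

/-- A covering: an isomorphism from the link of each vertex onto the link of its image. -/
def Hom.IsCovering {Y X : VHComplex} (p : Y.Hom X) : Prop :=
  ∀ v : Y.V,
    Set.BijOn p.onD {d | Y.src d = v} {d | X.src d = p.onV v} ∧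
    Set.BijOn p.onF {f | Y.src (Y.vside f) = v} {f | X.src (X.vside f) = p.onV v}

/-- A universal covering (of a connected complex). -/
def Hom.IsUniversalCover {Y X : VHComplex} (p : Y.Hom X) : Prop :=
  p.IsCovering ∧ Y.IsSimplyConnected

/-! ### Geometric realisation -/

open unitInterval in
/-- Points of the disjoint union of the vertices, of one copy of `[0,1]` for each oriented edge, and
of one copy of `[0,1]²` for each corner of a square (the square placed with that corner at the
origin). -/
inductive RawPoint (Z : VHComplex)
  | vertex (v : Z.V) : RawPoint Z
  | edge (d : Z.D) (t : I) : RawPoint Z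
  | square (f : Z.F) (x y : I) : RawPoint Z

open unitInterval in
/-- The identifications defining the geometric realisation (`σ t = 1 - t`): the two copies of an edge
are identified, so are the four copies of a square, and boundaries are glued along the attaching
maps. -/
inductive Glue (Z : VHComplex) : Z.RawPoint → Z.RawPoint → Prop
  | edge_inv (d : Z.D) (t : I) : Glue Z (.edge d t) (.edge (Z.inv d) (σ t))
  | edge_zero (d : Z.D) : Glue Z (.edge d 0) (.vertex (Z.src d))
  | square_flipH (f : Z.F) (x y : I) : Glue Z (.square f x y) (.square (Z.flipH f) (σ x) y)
  | square_flipV (f : Z.F) (x y : I) : Glue Z (.square f x y) (.square (Z.flipV f) x (σ y))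
  | square_left (f : Z.F) (y : I) : Glue Z (.square f 0 y) (.edge (Z.vside f) y)
  | square_bottom (f : Z.F) (x : I) : Glue Z (.square f x 0) (.edge (Z.hside f) x)

/-- The geometric realisation of a `VH`-complex. -/
def Realization (Z : VHComplex) : Type _ := Quot Z.Glue

open unitInterval

def vertexPt (Z : VHComplex) (v : Z.V) : Z.Realization := Quot.mk _ (.vertex v)

/-- The characteristic map of an edge. -/
def edgePt (Z : VHComplex) (d : Z.D) (t : I) : Z.Realization := Quot.mk _ (.edge d t)

/-- The characteristic map of a square. -/
def squarePt (Z : VHComplex) (f : Z.F) (q : I × I) : Z.Realization :=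
  Quot.mk _ (.square f q.1 q.2)

/-- The weak (CW) topology: a set is open if and only if its preimages under all the characteristic
maps of edges and squares are open. (All complexes considered below are locally finite, and then
this is also the topology of the metric `cellDist`.) -/
instance (Z : VHComplex) : TopologicalSpace Z.Realization :=
  (⨆ d : Z.D, TopologicalSpace.coinduced (Z.edgePt d) inferInstance) ⊔
    (⨆ f : Z.F, TopologicalSpace.coinduced (Z.squarePt f) inferInstance)

/-- `Z.HasString p q r`: there is a string `p = x₀, x₁, …, xₘ = q` of total length `r` in which any
two consecutive points lie in a common closed cell (a unit interval or a Euclidean unit square), the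
length being the sum of the distances between consecutive points measured in those cells. -/
inductive HasString (Z : VHComplex) (p : Z.Realization) : Z.Realization → ℝ → Prop
  | nil : HasString Z p p 0
  | edge (d : Z.D) (s t : I) (r : ℝ) :
      HasString Z p (Z.edgePt d s) r → HasString Z p (Z.edgePt d t) (r + |(s : ℝ) - t|)
  | square (f : Z.F) (a b : I × I) (r : ℝ) :
      HasString Z p (Z.squarePt f a) r →
      HasString Z p (Z.squarePt f b)
        (r + √(((a.1 : ℝ) - b.1) ^ 2 + ((a.2 : ℝ) - b.2) ^ 2))

/-- The intrinsic metric of a connected complex: the infimum of the lengths of strings. It is the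
`CAT(0)` metric when the complex is simply connected and nonpositively curved. -/
noncomputable def cellDist (Z : VHComplex) (p q : Z.Realization) : ℝ :=
  sInf {r | Z.HasString p q r}

/-! ### Lines, half-spaces, crossing -/

/-- The graph metric of the 1-skeleton is read off from this simple graph (loops and repeated edges
do not affect distances). -/
def oneSkeleton (Z : VHComplex) : SimpleGraph Z.V :=
  SimpleGraph.fromRel fun v w => ∃ d : Z.D, Z.src d = v ∧ Z.tgt d = w

/-- The map `ℝ → Z` which sends `[n, n + 1]` to the edge `ℓ n`. -/
noncomputable def linePt (Z : VHComplex) (ℓ : ℤ → Z.D) (t : ℝ) : Z.Realization :=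
  Z.edgePt (ℓ ⌊t⌋) ⟨Int.fract t, Int.fract_nonneg t, (Int.fract_lt_one t).le⟩

/-- (The image of) a combinatorial line: an isometric embedding into the 1-skeleton of the real line
subdivided at the integers, which is also an isometric embedding for the intrinsic metric. -/
def IsCombinatorialLine (Z : VHComplex) (L : Set Z.Realization) : Prop :=
  ∃ ℓ : ℤ → Z.D,
    (∀ n, Z.src (ℓ (n + 1)) = Z.tgt (ℓ n)) ∧
    (∀ m n, (Z.oneSkeleton.dist (Z.src (ℓ m)) (Z.src (ℓ n)) : ℤ) = |m - n|) ∧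
    (∀ s t : ℝ, Z.cellDist (Z.linePt ℓ s) (Z.linePt ℓ t) = |s - t|) ∧
    L = Set.range (Z.linePt ℓ)

/-! ### Regular neighbourhoods and regular spheres -/

/-- The closed cells of the subdivision of `[0,1]` into four intervals of equal length. -/
def IsQuarterCell (J : Set I) : Prop :=
  (∃ i : ℕ, i ≤ 4 ∧ J = {t : I | (t : ℝ) = i / 4}) ∨
    (∃ i : ℕ, i < 4 ∧ J = {t : I | (i : ℝ) / 4 ≤ t ∧ (t : ℝ) ≤ (i + 1) / 4})

/-- The closed cells of the second cubical subdivision, as subsets of the realisation. -/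
def IsSubdividedCell (Z : VHComplex) (c : Set Z.Realization) : Prop :=
  (∃ v, c = {Z.vertexPt v}) ∨
    (∃ d J, IsQuarterCell J ∧ c = Z.edgePt d '' J) ∨
    (∃ f J K, IsQuarterCell J ∧ IsQuarterCell K ∧ c = Z.squarePt f '' (J ×ˢ K))

/-- The cells of the regular neighbourhood `N(P)` of an embedded path `P`: the closed cells of the
second cubical subdivision that meet `P`, and their faces. -/
def IsRegularNbhdCell (Z : VHComplex) (P : Set Z.Realization) (c : Set Z.Realization) : Prop :=
  Z.IsSubdividedCell c ∧ ∃ c', Z.IsSubdividedCell c' ∧ (c' ∩ P).Nonempty ∧ c ⊆ c'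

/-- The regular sphere `∂N(P)`: the union of the cells of `N(P)` that are disjoint from `P`. -/
def regularSphere (Z : VHComplex) (P : Set Z.Realization) : Set Z.Realization :=
  ⋃₀ {c | Z.IsRegularNbhdCell P c ∧ Disjoint c P}

end VHComplex

/-- `A` separates the subset `B` of the subspace `W`: two points of `B` lie in different components
of `W \ A`. -/
def SeparatesIn {E : Type*} [TopologicalSpace E] (W A B : Set E) : Prop :=
  ∃ x ∈ B, ∃ y ∈ B, x ∈ W \ A ∧ y ∈ W \ A ∧
    connectedComponentIn (W \ A) x ≠ connectedComponentIn (W \ A) y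

/-- A half-space of `L`: the closure of a component of the complement of `L`. -/
def IsHalfSpace {E : Type*} [TopologicalSpace E] (L H : Set E) : Prop :=
  ∃ x ∈ Lᶜ, H = closure (connectedComponentIn Lᶜ x)

/-- `L` crosses `L'`: no half-space of `L'` contains `L`. -/
def Crosses {E : Type*} [TopologicalSpace E] (L L' : Set E) : Prop :=
  ∀ H, IsHalfSpace L' H → ¬ L ⊆ H

/-! ### Tubular graphs of graphs -/

/-- A tubular graph of graphs. The underlying finite connected graph has vertex set `S` and edge set
`A`, the two ends of an edge `a` being `ends a false` and `ends a true` (loops and multiple edges are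
allowed). Vertex spaces are finite connected simplicial graphs, edge spaces are simplicial circles
(finite connected graphs in which every vertex has exactly two neighbours), and the attaching maps
are simplicial immersions, that is, locally injective graph morphisms. -/
structure TubularGraphOfGraphs where
  S : Type*
  A : Type*
  finite_S : Finite S
  finite_A : Finite A
  ends : A → Bool → S
  nonempty_S : Nonempty S
  connected : ∀ s t : S, Relation.EqvGen (fun s t => ∃ a, ends a false = s ∧ ends a true = t) s t
  VertexSpace : S → Type*
  finite_vertexSpace : ∀ s, Finite (VertexSpace s)
  vertexGraph : ∀ s, SimpleGraph (VertexSpace s)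
  connected_vertexGraph : ∀ s, (vertexGraph s).Connected
  EdgeSpace : A → Type*
  finite_edgeSpace : ∀ a, Finite (EdgeSpace a)
  edgeGraph : ∀ a, SimpleGraph (EdgeSpace a)
  connected_edgeGraph : ∀ a, (edgeGraph a).Connected
  two_neighbours : ∀ a x, ((edgeGraph a).neighborSet x).ncard = 2
  attach : ∀ a b, edgeGraph a →g vertexGraph (ends a b)
  immersion : ∀ a b x, Set.InjOn (attach a b) ((edgeGraph a).neighborSet x)

/-- The geometric realisation of a tubular graph of graphs as a `VH`-complex. The vertical edges are
the edges of the vertex graphs; each vertex `x` of an edge graph gives the horizontal edge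
`{x} × [0,1]`, where `(a, x, b)` is oriented away from the end `b` of the tube `a`; each edge of
an edge graph gives the square (edge) `× [0,1]`. -/
def TubularGraphOfGraphs.realization (T : TubularGraphOfGraphs) : VHComplex where
  V := Σ s, T.VertexSpace s
  D := (Σ s, (T.vertexGraph s).Dart) ⊕ (Σ a, T.EdgeSpace a × Bool)
  F := Σ a, (T.edgeGraph a).Dart × Bool
  src
    | .inl ⟨s, d⟩ => ⟨s, d.fst⟩
    | .inr ⟨a, x, b⟩ => ⟨T.ends a b, T.attach a b x⟩
  inv
    | .inl ⟨s, d⟩ => .inl ⟨s, d.symm⟩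
    | .inr ⟨a, x, b⟩ => .inr ⟨a, x, !b⟩
  inv_inv := by rintro (⟨s, d⟩ | ⟨a, x, b⟩) <;> simp
  inv_ne := by
    rintro (⟨s, d⟩ | ⟨a, x, b⟩)
    · simpa using d.symm_ne
    · simp
  vertical d := d.isLeft = true
  vertical_inv := by rintro (⟨s, d⟩ | ⟨a, x, b⟩) <;> simp
  vside f := .inl ⟨T.ends f.1 f.2.2, (T.attach f.1 f.2.2).mapDart f.2.1⟩
  hside f := .inr ⟨f.1, f.2.1.fst, f.2.2⟩
  vertical_vside := by simp
  horizontal_hside := by simp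
  src_vside := by rintro ⟨a, d, b⟩; rfl
  flipH f := ⟨f.1, f.2.1, !f.2.2⟩
  flipV f := ⟨f.1, f.2.1.symm, f.2.2⟩
  flipH_flipH := by rintro ⟨a, d, b⟩; simp
  flipV_flipV := by rintro ⟨a, d, b⟩; simp
  flip_comm := by rintro ⟨a, d, b⟩; rfl
  flip_ne := by rintro ⟨a, d, b⟩; simp
  hside_flipH := by rintro ⟨a, d, b⟩; rfl
  vside_flipV := by rintro ⟨a, d, b⟩; rfl

/-!
The argument works with half-edges and squares. A combinatorial line is *straight*: it never turns at
a corner of a square, since the diagonal of that square would be a shortcut, and it never backtracks.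
For a square complex with vertical and horizontal edges whose corners are determined by their sides,
edge paths have unique normal forms, in which vertical edges are pushed to the right across squares;
straight paths are normal forms. Hence in a simply connected complex two straight lines meet in an
interval (`eq_of_isWalk_of_reduced`, `IsStraightLine.ordConnected_preimage`).

Since a link minus one vertex is connected, a component of the complement of a straight line that
touches one vertex of the line touches a square at each of the two adjacent edges of the line, and so
touches all of the line (`IsStraightLine.exists_linked`). In particular each half-space of `L'`
contains `L'`. If `P = L ∩ L'` is empty or not compact, then `L \ P` is connected, so that one
half-space of `L'` contains `L`. If `P` is a segment and the two points of `L` on the regular sphere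
`∂N(P)` are not separated by `L'` there, then both rays of `L \ P` lie in one component of the
complement of `L'`, and again `L` does not cross `L'`.

For the converse, the regular sphere of a segment is modelled by a graph whose vertices are the
half-edges leaving the segment. It is obtained by splicing vertex links, and has no cut vertices
(`IsStraightLine.sphereNoCut_seg`). Let `x, y` be the points of `L` on the sphere and suppose that
they lie in different components of the sphere minus `L'`, but in the same component of the
complement of `L'`. As `L'` separates, there is another complementary component of `L'`, which
meets the sphere in a point `z`. Then `x, y, z` lie in three different components of the sphere minus
its two points on `L'`. Since there are no cut vertices, removing `x` and `y` leaves the sphere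
connected (`EdgeSubgraph.SphereNoCut.sphereConn_pair`). But every component of the complement of `L`
meets the sphere, so that `L` is not separating, a contradiction.

Topologically, only one direction is needed: what is connected in the combinatorial model is connected
in the realisation, through explicit arcs in squares.
-/

/-! ### Uniqueness of reduced edge paths -/

namespace VHComplex

variable {Y : VHComplex}

/-- The corners of squares are determined by their two sides. -/
def CornersFaithful (Y : VHComplex) : Prop :=
  ∀ f g, Y.vside f = Y.vside g → Y.hside f = Y.hside g → f = g

/-- The pair `d, e` is a vertical side followed by a horizontal side of one square. -/
def VHTurn (Y : VHComplex) (d e : Y.D) : Prop :=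
  ∃ g, Y.vside g = d ∧ Y.hside (Y.flipV g) = e

/-- A word of oriented edges is reduced if it contains neither a backtrack nor a vertical side of a
square followed by a horizontal side of the same square. -/
def Reduced (Y : VHComplex) (w : List Y.D) : Prop :=
  w.IsChain fun d e => e ≠ Y.inv d ∧ ¬ Y.VHTurn d e

open Classical in
/-- Left multiplication of a reduced word by a letter, with values in reduced words: a vertical letter
is pushed to the right across squares as far as possible. -/
noncomputable def act (Y : VHComplex) : Y.D → List Y.D → List Y.D
  | d, [] => [d]
  | d, e :: w =>
    if e = Y.inv d then w
    else if h : Y.VHTurn d e then Y.hside h.choose :: act Y (Y.vside (Y.flipH h.choose)) w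
    else d :: e :: w

lemma vside_ne_hside (f g : Y.F) : Y.vside f ≠ Y.hside g := fun h =>
  Y.horizontal_hside g (h ▸ Y.vertical_vside f)

lemma vside_ne_inv_hside (f g : Y.F) : Y.vside f ≠ Y.inv (Y.hside g) := by
  rw [← Y.hside_flipH]; exact vside_ne_hside f _

lemma hside_ne_inv_vside (f g : Y.F) : Y.hside f ≠ Y.inv (Y.vside g) := by
  rw [← Y.vside_flipV]; exact (vside_ne_hside _ f).symm

lemma hside_flipV_flipH (g : Y.F) :
    Y.hside (Y.flipV (Y.flipH g)) = Y.inv (Y.hside (Y.flipV g)) := by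
  rw [← Y.flip_comm, Y.hside_flipH]

lemma vside_flipH_flipV (g : Y.F) :
    Y.vside (Y.flipH (Y.flipV g)) = Y.inv (Y.vside (Y.flipH g)) := by
  rw [Y.flip_comm, Y.vside_flipV]

lemma not_vhTurn_hside (f : Y.F) (e : Y.D) : ¬ Y.VHTurn (Y.hside f) e := by
  rintro ⟨g, hg, -⟩; exact vside_ne_hside _ _ hg

lemma act_cons_inv (d : Y.D) (w : List Y.D) : Y.act d (Y.inv d :: w) = w := by simp [act]

lemma act_cons_of_not {d e : Y.D} (w : List Y.D) (h₁ : e ≠ Y.inv d) (h₂ : ¬ Y.VHTurn d e) :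
    Y.act d (e :: w) = d :: e :: w := by simp [act, h₁, h₂]

lemma act_turn (hY : Y.CornersFaithful) (g : Y.F) (w : List Y.D) :
    Y.act (Y.vside g) (Y.hside (Y.flipV g) :: w) =
      Y.hside g :: Y.act (Y.vside (Y.flipH g)) w := by
  have h : Y.VHTurn (Y.vside g) (Y.hside (Y.flipV g)) := ⟨g, rfl, rfl⟩
  have hc : h.choose = g := by
    have hs := h.choose_spec
    have := hY (Y.flipV h.choose) (Y.flipV g) (by rw [Y.vside_flipV, Y.vside_flipV, hs.1]) hs.2
    rw [← Y.flipV_flipV h.choose, this, Y.flipV_flipV]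
  rw [act, if_neg (hside_ne_inv_vside _ _), dif_pos h, hc]

/-- The three ways in which a letter acts on a non-empty word. -/
lemma act_cases (d e : Y.D) :
    e = Y.inv d ∨ (∃ g, d = Y.vside g ∧ e = Y.hside (Y.flipV g)) ∨
      (e ≠ Y.inv d ∧ ¬ Y.VHTurn d e) := by
  by_cases h₁ : e = Y.inv d
  · exact .inl h₁
  by_cases h₂ : Y.VHTurn d e
  · obtain ⟨g, rfl, rfl⟩ := h₂
    exact .inr (.inl ⟨g, rfl, rfl⟩)
  · exact .inr (.inr ⟨h₁, h₂⟩)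

/-- After pushing a vertical letter across a square, the horizontal side in front cannot cancel. -/
lemma head_act_ne (hY : Y.CornersFaithful) (g : Y.F) (w : List Y.D)
    (hw : Y.Reduced (Y.hside (Y.flipV g) :: w)) :
    ∀ x ∈ (Y.act (Y.vside (Y.flipH g)) w).head?, x ≠ Y.inv (Y.hside g) := by
  cases w with
  | nil =>
    simp only [act, List.head?_cons, Option.mem_def, Option.some.injEq, forall_eq']
    exact vside_ne_inv_hside _ _
  | cons e w =>
    obtain ⟨hw₁, hw₂⟩ := List.isChain_cons_cons.1 hw
    rcases act_cases (Y.vside (Y.flipH g)) e with rfl | ⟨k, hk, rfl⟩ | ⟨h₁, h₂⟩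
    · rw [act_cons_inv]
      rintro x hx rfl
      cases w with
      | nil => simp at hx
      | cons y w =>
        simp only [List.head?_cons, Option.mem_def, Option.some.injEq] at hx
        refine (List.isChain_cons_cons.1 hw₂).1.2 ⟨Y.flipV (Y.flipH g), ?_, ?_⟩
        · rw [Y.vside_flipV]
        · rw [Y.flipV_flipV, Y.hside_flipH, hx]
    · rw [hk, act_turn hY]
      simp only [List.head?_cons, Option.mem_def, Option.some.injEq, forall_eq']
      rw [← Y.hside_flipH]
      intro h
      have := hY _ _ hk h.symm
      subst this
      exact hw₁.1 (hside_flipV_flipH g)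
    · rw [act_cons_of_not _ h₁ h₂]
      simp only [List.head?_cons, Option.mem_def, Option.some.injEq, forall_eq']
      exact vside_ne_inv_hside _ _

lemma reduced_act (hY : Y.CornersFaithful) (d : Y.D) (w : List Y.D) (hw : Y.Reduced w) :
    Y.Reduced (Y.act d w) := by
  induction w generalizing d with
  | nil => simp [act, Reduced]
  | cons e w ih =>
    rcases act_cases d e with rfl | ⟨g, rfl, rfl⟩ | ⟨h₁, h₂⟩
    · rw [act_cons_inv]; exact hw.tail
    · rw [act_turn hY]
      refine List.isChain_cons.2 ⟨fun x hx => ⟨head_act_ne hY g w hw x hx, not_vhTurn_hside _ _⟩, ?_⟩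
      exact ih _ hw.tail
    · rw [act_cons_of_not _ h₁ h₂]
      exact List.isChain_cons_cons.2 ⟨⟨h₁, h₂⟩, hw⟩

lemma act_of_reduced_cons {d : Y.D} {w : List Y.D} (hw : Y.Reduced (d :: w)) :
    Y.act d w = d :: w := by
  cases w with
  | nil => simp [act]
  | cons e w =>
    have := (List.isChain_cons_cons.1 hw).1
    exact act_cons_of_not _ this.1 this.2

lemma act_act_inv (hY : Y.CornersFaithful) (d : Y.D) (w : List Y.D) (hw : Y.Reduced w) :
    Y.act d (Y.act (Y.inv d) w) = w := by
  induction w generalizing d with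
  | nil => simp [act]
  | cons e w ih =>
    rcases act_cases (Y.inv d) e with rfl | ⟨g, hg, rfl⟩ | ⟨h₁, h₂⟩
    · rw [act_cons_inv, Y.inv_inv]
      rw [Y.inv_inv] at hw
      exact act_of_reduced_cons hw
    · rw [hg, act_turn hY]
      have hd : d = Y.vside (Y.flipV g) := by rw [Y.vside_flipV, ← hg, Y.inv_inv]
      have h := act_turn hY (Y.flipV g) (Y.act (Y.vside (Y.flipH g)) w)
      rw [Y.flipV_flipV] at h
      rw [hd, h, vside_flipH_flipV]
      have h' := ih (Y.inv (Y.vside (Y.flipH g))) hw.tail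
      rw [Y.inv_inv] at h'
      rw [h']
    · rw [act_cons_of_not _ h₁ h₂, act_cons_inv]

lemma act_square (hY : Y.CornersFaithful) (g : Y.F) (w : List Y.D) (hw : Y.Reduced w) :
    Y.act (Y.hside g) (Y.act (Y.vside (Y.flipH g)) w) =
      Y.act (Y.vside g) (Y.act (Y.hside (Y.flipV g)) w) := by
  have key : Y.Reduced (Y.hside (Y.flipV g) :: w) →
      Y.act (Y.hside g) (Y.act (Y.vside (Y.flipH g)) w) =
        Y.act (Y.vside g) (Y.act (Y.hside (Y.flipV g)) w) := by
    intro h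
    rw [act_of_reduced_cons h, act_turn hY]
    apply act_of_reduced_cons
    exact List.isChain_cons.2
      ⟨fun x hx => ⟨head_act_ne hY g w h x hx, not_vhTurn_hside _ _⟩, reduced_act hY _ _ hw⟩
  cases w with
  | nil => exact key (by simp [Reduced])
  | cons e w =>
    by_cases he : e = Y.inv (Y.hside (Y.flipV g))
    · subst he
      rw [act_cons_inv, ← hside_flipV_flipH, act_turn hY, Y.flipH_flipH, Y.hside_flipH, act_cons_inv]
    · exact key (List.isChain_cons_cons.2 ⟨⟨he, not_vhTurn_hside _ _⟩, hw⟩)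

/-- The action of a word on reduced words. -/
noncomputable def actWord (Y : VHComplex) (l w : List Y.D) : List Y.D := l.foldr Y.act w

lemma actWord_append (l l' w : List Y.D) :
    Y.actWord (l ++ l') w = Y.actWord l (Y.actWord l' w) := by simp [actWord]

lemma reduced_actWord (hY : Y.CornersFaithful) (l w : List Y.D) (hw : Y.Reduced w) :
    Y.Reduced (Y.actWord l w) := by
  induction l with
  | nil => exact hw
  | cons d l ih => exact reduced_act hY _ _ ih

lemma actWord_nil_of_reduced {l : List Y.D} (hl : Y.Reduced l) : Y.actWord l [] = l := by
  induction l with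
  | nil => rfl
  | cons d l ih =>
    change Y.act d (Y.actWord l []) = _
    rw [ih hl.tail, act_of_reduced_cons hl]

/-- The action of a word depends on its homotopy class only. -/
lemma actWord_eq_of_homotopic (hY : Y.CornersFaithful) {v w : Y.V} {l l' : List Y.D}
    (h : Y.Homotopic v w l l') (u : List Y.D) (hu : Y.Reduced u) :
    Y.actWord l u = Y.actWord l' u := by
  induction h with
  | rel l l' h =>
    obtain ⟨-, -, h⟩ := h
    cases h with
    | backtrack l₁ l₂ d =>
      simp only [actWord_append]
      congr 1
      exact act_act_inv hY d _ (reduced_actWord hY _ _ hu)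
    | square l₁ l₂ f =>
      simp only [actWord_append]
      congr 1
      exact act_square hY f _ (reduced_actWord hY _ _ hu)
  | refl => rfl
  | symm _ _ _ ih => exact ih.symm
  | trans _ _ _ _ _ ih₁ ih₂ => exact ih₁.trans ih₂

/-- The reverse of an edge path. -/
def revWord (Y : VHComplex) (l : List Y.D) : List Y.D := (l.map Y.inv).reverse

lemma actWord_revWord (hY : Y.CornersFaithful) (l u : List Y.D) (hu : Y.Reduced u) :
    Y.actWord (Y.revWord l) (Y.actWord l u) = u := by
  induction l with
  | nil => rfl
  | cons d l ih =>
    have h : Y.revWord (d :: l) = Y.revWord l ++ [Y.inv d] := by simp [revWord]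
    rw [h, actWord_append]
    change Y.actWord _ (Y.act (Y.inv d) (Y.act d (Y.actWord l u))) = u
    have h' := act_act_inv hY (Y.inv d) _ (reduced_actWord hY l u hu)
    rw [Y.inv_inv] at h'
    rw [h', ih]

lemma IsWalk.append {u v w : Y.V} {l l' : List Y.D} (h : Y.IsWalk u l v) (h' : Y.IsWalk v l' w) :
    Y.IsWalk u (l ++ l') w := by
  induction h with
  | nil => exact h'
  | cons d l w _ ih => exact .cons d _ _ (ih h')

lemma isWalk_singleton (d : Y.D) : Y.IsWalk (Y.src d) [d] (Y.tgt d) := .cons _ _ _ (.nil _)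

lemma IsWalk.rev {u v : Y.V} {l : List Y.D} (h : Y.IsWalk u l v) : Y.IsWalk v (Y.revWord l) u := by
  induction h with
  | nil v => exact .nil v
  | cons d l w _ ih =>
    have h : Y.revWord (d :: l) = Y.revWord l ++ [Y.inv d] := by simp [revWord]
    rw [h]
    have h' := isWalk_singleton (Y.inv d)
    rw [tgt, Y.inv_inv] at h'
    exact ih.append h'

/-- In a simply connected nonpositively curved `VH`-complex there is at most one reduced edge path
between two vertices. -/
theorem eq_of_isWalk_of_reduced (hY : Y.CornersFaithful) (hsc : Y.IsSimplyConnected) {v w : Y.V}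
    {l l' : List Y.D} (hl : Y.IsWalk v l w) (hl' : Y.IsWalk v l' w)
    (hr : Y.Reduced l) (hr' : Y.Reduced l') : l = l' := by
  have h := actWord_eq_of_homotopic hY (hsc.2 v _ (hl.append hl'.rev)) l' hr'
  rw [actWord_append] at h
  have h' := actWord_revWord hY l' [] (by simp [Reduced])
  rw [actWord_nil_of_reduced hr'] at h'
  rw [h', actWord_nil_of_reduced hr] at h
  exact h

end VHComplex

/-! ### Links of the universal cover -/

/-- A path from outside a set `T` into `T` has an initial piece outside `T` followed by one step into
`T`. -/
lemma Relation.ReflTransGen.exists_first_hit {α : Type*} {r : α → α → Prop} {T : α → Prop} {x t : α}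
    (h : Relation.ReflTransGen r x t) (hx : ¬ T x) (ht : T t) :
    ∃ u v, Relation.ReflTransGen (fun a b => r a b ∧ ¬ T a ∧ ¬ T b) x u ∧ ¬ T u ∧ r u v ∧ T v := by
  induction h using Relation.ReflTransGen.head_induction_on with
  | refl => exact absurd ht hx
  | @head a c hac _ ih =>
    by_cases hc : T c
    · exact ⟨a, c, .refl, hx, hac, hc⟩
    · obtain ⟨u, v, h₁, h₂⟩ := ih hc
      exact ⟨u, v, .head ⟨hac, hx, hc⟩ h₁, h₂⟩

lemma Relation.ReflTransGen.imp {α : Type*} {r s : α → α → Prop} {x y : α}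
    (h : Relation.ReflTransGen r x y) (hrs : ∀ a b, r a b → s a b) : Relation.ReflTransGen s x y :=
  Relation.ReflTransGen.mono (fun a b hab => hrs a b hab) x y h

namespace VHComplex

variable {Y : VHComplex}

/-- The oriented edges `d` and `e` are the two sides of a square at one of its corners. -/
def Corner (Y : VHComplex) (d e : Y.D) : Prop :=
  ∃ f, (Y.vside f = d ∧ Y.hside f = e) ∨ (Y.vside f = e ∧ Y.hside f = d)

/-- There is a square with one side `e`, whose two neighbouring sides, oriented away from `e`, are
`d` at the start of `e` and `d'` at the end of `e`. -/
def Opp (Y : VHComplex) (e d d' : Y.D) : Prop :=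
  ∃ f, (Y.hside f = e ∧ Y.vside f = d ∧ Y.vside (Y.flipH f) = d') ∨
    (Y.vside f = e ∧ Y.hside f = d ∧ Y.hside (Y.flipV f) = d')

lemma Corner.symm {d e : Y.D} (h : Y.Corner d e) : Y.Corner e d := by
  obtain ⟨f, h⟩ := h; exact ⟨f, h.symm⟩

lemma Corner.src_eq {d e : Y.D} (h : Y.Corner d e) : Y.src d = Y.src e := by
  obtain ⟨f, ⟨rfl, rfl⟩ | ⟨rfl, rfl⟩⟩ := h
  exacts [Y.src_vside f, (Y.src_vside f).symm]

lemma Corner.exists_opp {d e : Y.D} (h : Y.Corner d e) : ∃ d', Y.Opp e d d' := by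
  obtain ⟨f, ⟨rfl, rfl⟩ | ⟨rfl, rfl⟩⟩ := h
  exacts [⟨_, f, .inl ⟨rfl, rfl, rfl⟩⟩, ⟨_, f, .inr ⟨rfl, rfl, rfl⟩⟩]

lemma Opp.corner {e d d' : Y.D} (h : Y.Opp e d d') : Y.Corner d e := by
  obtain ⟨f, ⟨rfl, rfl, -⟩ | ⟨rfl, rfl, -⟩⟩ := h
  exacts [⟨f, .inl ⟨rfl, rfl⟩⟩, ⟨f, .inr ⟨rfl, rfl⟩⟩]

lemma Opp.symm {e d d' : Y.D} (h : Y.Opp e d d') : Y.Opp (Y.inv e) d' d := by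
  obtain ⟨f, ⟨rfl, rfl, rfl⟩ | ⟨rfl, rfl, rfl⟩⟩ := h
  · exact ⟨Y.flipH f, .inl ⟨Y.hside_flipH f, rfl, by rw [Y.flipH_flipH]⟩⟩
  · exact ⟨Y.flipV f, .inr ⟨Y.vside_flipV f, rfl, by rw [Y.flipV_flipV]⟩⟩

lemma Opp.corner' {e d d' : Y.D} (h : Y.Opp e d d') : Y.Corner d' (Y.inv e) := h.symm.corner

lemma VHTurn.corner {d e : Y.D} (h : Y.VHTurn d e) : Y.Corner (Y.inv d) e := by
  obtain ⟨g, rfl, rfl⟩ := h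
  exact ⟨Y.flipV g, .inl ⟨Y.vside_flipV g, rfl⟩⟩

/-- Vertex links are connected, and stay so after the removal of a vertex `z` (there is no condition
on `z`, so that for `z` outside the link this says that the link is connected). -/
def LinksNoCut (Y : VHComplex) : Prop :=
  ∀ z d d' : Y.D, Y.src d = Y.src d' → d ≠ z → d' ≠ z →
    Relation.ReflTransGen (fun a b => Y.Corner a b ∧ a ≠ z ∧ b ≠ z) d d'

lemma IsBradyMeier.reflTransGen_corner {Z : VHComplex} (hZ : Z.IsBradyMeier) {d d' : Z.D}
    (h : Z.src d = Z.src d') : Relation.ReflTransGen Z.Corner d d' := by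
  have hr := (hZ (Z.src d')).1.preconnected ⟨d, h⟩ ⟨d', rfl⟩
  rw [SimpleGraph.reachable_iff_reflTransGen] at hr
  exact Relation.ReflTransGen.lift (p := Z.Corner)
    (fun a : {d : Z.D // Z.src d = Z.src d'} => a.1) (fun _ _ hab => hab) _ _ hr

lemma IsBradyMeier.reflTransGen_corner_ne {Z : VHComplex} (hZ : Z.IsBradyMeier) {z d d' : Z.D}
    (hd : Z.src d = Z.src z) (hd' : Z.src d' = Z.src z) (hdz : d ≠ z) (hdz' : d' ≠ z) :
    Relation.ReflTransGen (fun a b => Z.Corner a b ∧ a ≠ z ∧ b ≠ z) d d' := by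
  have hr := ((hZ (Z.src z)).2.1 ⟨z, rfl⟩).preconnected
    ⟨⟨d, hd⟩, fun h => hdz (congrArg Subtype.val h)⟩
    ⟨⟨d', hd'⟩, fun h => hdz' (congrArg Subtype.val h)⟩
  rw [SimpleGraph.reachable_iff_reflTransGen] at hr
  refine hr.lift (p := fun a b => Z.Corner a b ∧ a ≠ z ∧ b ≠ z) (fun a => a.1.1) ?_
  rintro ⟨⟨a, ha⟩, ha'⟩ ⟨⟨b, hb⟩, hb'⟩ hab
  exact ⟨hab, fun h => ha' (Subtype.ext h), fun h => hb' (Subtype.ext h)⟩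

lemma Hom.IsCovering.exists_corner {X : VHComplex} {p : Y.Hom X} (hp : p.IsCovering) {d : Y.D}
    {e : X.D} (h : X.Corner (p.onD d) e) : ∃ e', Y.Corner d e' ∧ p.onD e' = e := by
  have hcov := hp (Y.src d)
  have hsrc := h.src_eq
  obtain ⟨f, h⟩ := h
  have hf : X.src (X.vside f) = p.onV (Y.src d) := by
    rw [p.map_src]
    rcases h with ⟨h, -⟩ | ⟨h, -⟩
    · rw [h]
    · rw [h, ← hsrc]
  obtain ⟨f', hf', rfl⟩ := hcov.2.surjOn hf
  rw [← p.map_vside, ← p.map_hside] at h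
  rcases h with ⟨h, rfl⟩ | ⟨rfl, h⟩
  · have := hcov.1.injOn hf' (show Y.src d = Y.src d from rfl) h
    exact ⟨_, ⟨f', .inl ⟨this, rfl⟩⟩, rfl⟩
  · have := hcov.1.injOn ((Y.src_vside f').symm.trans hf') (show Y.src d = Y.src d from rfl) h
    exact ⟨_, ⟨f', .inr ⟨rfl, this⟩⟩, rfl⟩

/-- A path in a link of the base, with vertices in `Q`, lifts to a link of the covering space. -/
lemma Hom.IsCovering.exists_lift {X : VHComplex} {p : Y.Hom X} (hp : p.IsCovering)
    {Q : X.D → Prop} {d : Y.D} {e : X.D}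
    (h : Relation.ReflTransGen (fun a b => X.Corner a b ∧ Q a ∧ Q b) (p.onD d) e) :
    ∃ d', p.onD d' = e ∧ Y.src d' = Y.src d ∧
      Relation.ReflTransGen (fun a b => Y.Corner a b ∧ Q (p.onD a) ∧ Q (p.onD b)) d d' := by
  induction h with
  | refl => exact ⟨d, rfl, rfl, .refl⟩
  | tail _ h ih =>
    obtain ⟨b, rfl, hb, hdb⟩ := ih
    obtain ⟨c, hbc, rfl⟩ := hp.exists_corner h.1
    exact ⟨c, rfl, hbc.src_eq.symm.trans hb, hdb.tail ⟨hbc, h.2⟩⟩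

lemma Hom.IsCovering.linksNoCut {X : VHComplex} {p : Y.Hom X} (hp : p.IsCovering)
    (hX : X.IsBradyMeier) : Y.LinksNoCut := by
  intro z d d' hdd' hd hd'
  have hinj := (hp (Y.src d)).1.injOn
  have hsrc : X.src (p.onD d) = X.src (p.onD d') := by rw [← p.map_src, ← p.map_src, hdd']
  by_cases hz : Y.src z = Y.src d
  · have hzsrc : X.src (p.onD d) = X.src (p.onD z) := by rw [← p.map_src, ← p.map_src, hz]
    obtain ⟨c, hc, hcd, h⟩ := hp.exists_lift (Q := fun a => a ≠ p.onD z)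
      (hX.reflTransGen_corner_ne hzsrc (hsrc ▸ hzsrc) (fun h => hd (hinj rfl hz h))
        (fun h => hd' (hinj hdd'.symm hz h)))
    obtain rfl : c = d' := hinj hcd hdd'.symm hc
    exact h.imp fun a b hab => ⟨hab.1, fun h => hab.2.1 (h ▸ rfl), fun h => hab.2.2 (h ▸ rfl)⟩
  · obtain ⟨c, hc, hcd, h⟩ := hp.exists_lift (Q := fun _ => True)
      (by simpa using hX.reflTransGen_corner hsrc)
    obtain rfl : c = d' := hinj hcd hdd'.symm hc
    clear hc hcd
    induction h with
    | refl => exact .refl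
    | @tail b c hdb hbc ih =>
      have hb : Y.src b = Y.src d := (hbc.1.src_eq).trans hdd'.symm
      have hbz : b ≠ z := fun h => hz (h ▸ hb)
      refine (ih hb.symm hbz ?_).tail ⟨hbc.1, hbz, hd'⟩
      rw [← p.map_src, ← p.map_src, hb]

lemma Hom.IsCovering.cornersFaithful {X : VHComplex} {p : Y.Hom X} (hp : p.IsCovering)
    (hX : X.CornersFaithful) : Y.CornersFaithful := by
  intro f g hv hh
  refine (hp (Y.src (Y.vside f))).2.injOn rfl (congrArg Y.src hv.symm) (hX _ _ ?_ ?_)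
  · rw [← p.map_vside, ← p.map_vside, hv]
  · rw [← p.map_hside, ← p.map_hside, hh]

end VHComplex

/-- The attaching maps being immersions, no two corners of squares have the same sides. -/
lemma TubularGraphOfGraphs.cornersFaithful (T : TubularGraphOfGraphs) :
    T.realization.CornersFaithful := by
  rintro ⟨a, ⟨⟨x, y⟩, hxy⟩, b⟩ ⟨a', ⟨⟨x', y'⟩, hxy'⟩, b'⟩ hv hh
  simp only [realization, Sum.inr.injEq, Sigma.mk.injEq] at hh
  obtain ⟨rfl, hh⟩ := hh
  simp only [heq_eq_eq, Prod.mk.injEq] at hh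
  obtain ⟨rfl, rfl⟩ := hh
  simp only [realization, Sum.inl.injEq, Sigma.mk.injEq, heq_eq_eq, true_and] at hv
  have hy : T.attach a b y = T.attach a b y' := congrArg (fun d => d.snd) hv
  obtain rfl := T.immersion a b x hxy hxy' hy
  rfl

namespace VHComplex

open unitInterval

variable {Y : VHComplex}

/-! ### Points of the realisation -/

lemma edgePt_zero (d : Y.D) : Y.edgePt d 0 = Y.vertexPt (Y.src d) := Quot.sound (.edge_zero d)

lemma edgePt_inv (d : Y.D) (t : I) : Y.edgePt (Y.inv d) t = Y.edgePt d (σ t) := by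
  have := Quot.sound (Glue.edge_inv (Z := Y) d (σ t))
  rw [symm_symm] at this
  exact this.symm

lemma edgePt_one (d : Y.D) : Y.edgePt d 1 = Y.vertexPt (Y.tgt d) := by
  rw [tgt, ← edgePt_zero, edgePt_inv, symm_zero]

lemma squarePt_left (f : Y.F) (y : I) : Y.squarePt f (0, y) = Y.edgePt (Y.vside f) y :=
  Quot.sound (.square_left f y)

lemma squarePt_bottom (f : Y.F) (x : I) : Y.squarePt f (x, 0) = Y.edgePt (Y.hside f) x :=
  Quot.sound (.square_bottom f x)

lemma squarePt_flipH (f : Y.F) (x y : I) :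
    Y.squarePt (Y.flipH f) (x, y) = Y.squarePt f (σ x, y) := by
  have := Quot.sound (Glue.square_flipH (Z := Y) f (σ x) y)
  rw [symm_symm] at this
  exact this.symm

lemma squarePt_flipV (f : Y.F) (x y : I) :
    Y.squarePt (Y.flipV f) (x, y) = Y.squarePt f (x, σ y) := by
  have := Quot.sound (Glue.square_flipV (Z := Y) f x (σ y))
  rw [symm_symm] at this
  exact this.symm

lemma squarePt_right (f : Y.F) (y : I) : Y.squarePt f (1, y) = Y.edgePt (Y.vside (Y.flipH f)) y := by
  rw [← squarePt_left, squarePt_flipH, symm_zero]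

lemma squarePt_top (f : Y.F) (x : I) : Y.squarePt f (x, 1) = Y.edgePt (Y.hside (Y.flipV f)) x := by
  rw [← squarePt_bottom, squarePt_flipV, symm_zero]

lemma continuous_edgePt (d : Y.D) : Continuous (Y.edgePt d) :=
  continuous_iff_coinduced_le.2 ((le_iSup (fun d : Y.D =>
    TopologicalSpace.coinduced (Y.edgePt d) inferInstance) d).trans le_sup_left)

lemma continuous_squarePt (f : Y.F) : Continuous (Y.squarePt f) :=
  continuous_iff_coinduced_le.2 ((le_iSup (fun f : Y.F =>
    TopologicalSpace.coinduced (Y.squarePt f) inferInstance) f).trans le_sup_right)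

/-- A predicate on the points of the 1-skeleton, given by `e` on edges and by `W` on vertices,
extended by `False` to the open squares. -/
def skelPred (e : Y.D → I → Prop) (W : Y.V → Prop) : Y.RawPoint → Prop
  | .vertex v => W v
  | .edge d t => e d t
  | .square f x y => (x = 0 ∧ e (Y.vside f) y) ∨ (x = 1 ∧ e (Y.vside (Y.flipH f)) y) ∨
      (y = 0 ∧ e (Y.hside f) x) ∨ (y = 1 ∧ e (Y.hside (Y.flipV f)) x)

lemma skelPred_glue {e : Y.D → I → Prop} {W : Y.V → Prop}
    (he : ∀ d t, e (Y.inv d) t ↔ e d (σ t)) (h0 : ∀ d, e d 0 ↔ W (Y.src d))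
    (a b : Y.RawPoint) (h : Y.Glue a b) : skelPred e W a = skelPred e W b := by
  have h1 : ∀ d, e d 1 ↔ W (Y.tgt d) := fun d => by rw [tgt, ← h0, he, symm_zero]
  apply propext
  cases h with
  | edge_inv d t => simp [skelPred, he]
  | edge_zero d => simp [skelPred, h0]
  | square_flipH f x y =>
    simp only [skelPred, symm_eq_zero, symm_eq_one, Y.flipH_flipH, Y.hside_flipH, he, symm_symm,
      hside_flipV_flipH]
    tauto
  | square_flipV f x y =>
    simp only [skelPred, symm_eq_zero, symm_eq_one, Y.flipV_flipV, Y.vside_flipV, he, symm_symm,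
      vside_flipH_flipV]
    tauto
  | square_left f y =>
    simp only [skelPred]
    constructor
    · rintro (⟨-, h⟩ | ⟨h, -⟩ | ⟨rfl, h⟩ | ⟨rfl, h⟩)
      · exact h
      · exact absurd h zero_ne_one
      · rwa [h0, Y.src_vside, ← h0]
      · rwa [h0, ← Y.src_vside, Y.vside_flipV, ← h0, he, symm_zero] at h
    · exact fun h => .inl ⟨trivial, h⟩
  | square_bottom f x =>
    simp only [skelPred]
    constructor
    · rintro (⟨rfl, h⟩ | ⟨rfl, h⟩ | ⟨-, h⟩ | ⟨h, -⟩)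
      · rwa [h0, ← Y.src_vside, ← h0]
      · rwa [h0, Y.src_vside, Y.hside_flipH, ← h0, he, symm_zero] at h
      · exact h
      · exact absurd h zero_ne_one
    · exact fun h => .inr (.inr (.inl ⟨trivial, h⟩))

/-- The subset of the realisation defined by `skelPred`. -/
def skelLift (e : Y.D → I → Prop) (W : Y.V → Prop)
    (he : ∀ d t, e (Y.inv d) t ↔ e d (σ t)) (h0 : ∀ d, e d 0 ↔ W (Y.src d)) :
    Y.Realization → Prop :=
  Quot.lift (skelPred e W) (skelPred_glue he h0)

/-- Two coordinates for one point in the interior of an edge agree up to orientation. -/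
lemma eq_of_edgePt_eq {d d' : Y.D} {s t : I} (ht0 : t ≠ 0) (ht1 : t ≠ 1)
    (h : Y.edgePt d' s = Y.edgePt d t) : (d' = d ∧ s = t) ∨ (d' = Y.inv d ∧ s = σ t) := by
  let Q := skelLift (Y := Y) (fun d' s => (d' = d ∧ s = t) ∨ (d' = Y.inv d ∧ s = σ t))
    (fun _ => False)
    (fun d' s => by
      have h1 : Y.inv d' = d ↔ d' = Y.inv d :=
        ⟨fun h => by rw [← h, Y.inv_inv], fun h => by rw [h, Y.inv_inv]⟩
      have h2 : Y.inv d' = Y.inv d ↔ d' = d :=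
        ⟨fun h => by rw [← Y.inv_inv d', h, Y.inv_inv], fun h => by rw [h]⟩
      have h3 : σ s = t ↔ s = σ t :=
        ⟨fun h => by rw [← h, symm_symm], fun h => by rw [h, symm_symm]⟩
      rw [h1, h2, h3, symm_bijective.injective.eq_iff]
      tauto)
    (fun d' => by
      simp only [iff_false, not_or, not_and]
      exact ⟨fun _ h => ht0 h.symm, fun _ h => ht1 (symm_eq_zero.1 h.symm)⟩)
  have hQ : Q (Y.edgePt d t) := .inl ⟨rfl, rfl⟩
  rw [← h] at hQ
  exact hQ

/-! ### Subgraphs of the 1-skeleton -/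

/-- A subgraph of the 1-skeleton: a set of vertices and a set of edges (with both orientations),
containing the endpoints of its edges. -/
structure EdgeSubgraph (Y : VHComplex) where
  verts : Set Y.V
  edges : Set Y.D
  inv_mem : ∀ d ∈ edges, Y.inv d ∈ edges
  src_mem : ∀ d ∈ edges, Y.src d ∈ verts

namespace EdgeSubgraph

variable (G : Y.EdgeSubgraph)

lemma inv_mem_iff {d : Y.D} : Y.inv d ∈ G.edges ↔ d ∈ G.edges :=
  ⟨fun h => by simpa [Y.inv_inv] using G.inv_mem _ h, G.inv_mem d⟩

lemma tgt_mem {d : Y.D} (h : d ∈ G.edges) : Y.tgt d ∈ G.verts := G.src_mem _ (G.inv_mem d h)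

/-- The geometric realisation of a subgraph. -/
def carrier : Set Y.Realization :=
  {x | (∃ v ∈ G.verts, x = Y.vertexPt v) ∨ ∃ d ∈ G.edges, ∃ t, x = Y.edgePt d t}

/-- Membership in a subgraph is decided on representatives of points. -/
lemma lift_iff_mem_carrier (x : Y.Realization) :
    skelLift (Y := Y)
      (fun d t => d ∈ G.edges ∨ (t = 0 ∧ Y.src d ∈ G.verts) ∨ (t = 1 ∧ Y.tgt d ∈ G.verts))
      (fun v => v ∈ G.verts)
      (fun d t => by
        rw [G.inv_mem_iff, symm_eq_zero, symm_eq_one, tgt, Y.inv_inv, tgt]; tauto)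
      (fun d => by
        have := G.src_mem d
        simp only [true_and, zero_ne_one, false_and, or_false]; tauto) x ↔ x ∈ G.carrier := by
  set Q := skelLift (Y := Y)
      (fun d t => d ∈ G.edges ∨ (t = 0 ∧ Y.src d ∈ G.verts) ∨ (t = 1 ∧ Y.tgt d ∈ G.verts))
      (fun v => v ∈ G.verts) _ _ with hQ
  have hedge : ∀ d t, (d ∈ G.edges ∨ (t = 0 ∧ Y.src d ∈ G.verts) ∨ (t = 1 ∧ Y.tgt d ∈ G.verts)) →
      Y.edgePt d t ∈ G.carrier := by
    rintro d t (h | ⟨rfl, h⟩ | ⟨rfl, h⟩)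
    · exact .inr ⟨d, h, t, rfl⟩
    · exact .inl ⟨_, h, edgePt_zero d⟩
    · exact .inl ⟨_, h, edgePt_one d⟩
  constructor
  · intro h
    induction x using Quot.ind with
    | mk a =>
      cases a with
      | vertex v => exact .inl ⟨v, h, rfl⟩
      | edge d t => exact hedge d t h
      | square f x y =>
        change Y.squarePt f (x, y) ∈ _
        rcases h with ⟨rfl, h⟩ | ⟨rfl, h⟩ | ⟨rfl, h⟩ | ⟨rfl, h⟩
        · rw [squarePt_left]; exact hedge _ _ h
        · rw [squarePt_right]; exact hedge _ _ h
        · rw [squarePt_bottom]; exact hedge _ _ h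
        · rw [squarePt_top]; exact hedge _ _ h
  · rintro (⟨v, hv, rfl⟩ | ⟨d, hd, t, rfl⟩)
    · exact hv
    · exact .inl hd

lemma vertexPt_mem_carrier {v : Y.V} : Y.vertexPt v ∈ G.carrier ↔ v ∈ G.verts :=
  (G.lift_iff_mem_carrier _).symm

lemma edgePt_mem_carrier {d : Y.D} {t : I} : Y.edgePt d t ∈ G.carrier ↔
    d ∈ G.edges ∨ (t = 0 ∧ Y.src d ∈ G.verts) ∨ (t = 1 ∧ Y.tgt d ∈ G.verts) :=
  (G.lift_iff_mem_carrier _).symm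

lemma boundary_of_squarePt_mem {f : Y.F} {q : I × I} (h : Y.squarePt f q ∈ G.carrier) :
    q.1 = 0 ∨ q.1 = 1 ∨ q.2 = 0 ∨ q.2 = 1 := by
  have := (G.lift_iff_mem_carrier _).2 h
  rcases this with ⟨h, -⟩ | ⟨h, -⟩ | ⟨h, -⟩ | ⟨h, -⟩ <;> simp [h]

lemma carrier_inter (G G' H : Y.EdgeSubgraph) (hv : H.verts = G.verts ∩ G'.verts)
    (he : H.edges = G.edges ∩ G'.edges) : H.carrier = G.carrier ∩ G'.carrier := by
  have hedge : ∀ d t, Y.edgePt d t ∈ G.carrier → Y.edgePt d t ∈ G'.carrier →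
      Y.edgePt d t ∈ H.carrier := by
    intro d t h h'
    rw [edgePt_mem_carrier, hv, he]
    rw [edgePt_mem_carrier] at h h'
    have h₁ := G.src_mem d
    have h₂ := G'.src_mem d
    have h₃ := @EdgeSubgraph.tgt_mem _ G d
    have h₄ := @EdgeSubgraph.tgt_mem _ G' d
    simp only [Set.mem_inter_iff]
    by_cases ht : t = 0
    · have : t ≠ 1 := by rintro rfl; exact one_ne_zero ht
      tauto
    · tauto
  ext x
  constructor
  · rintro (⟨v, h, rfl⟩ | ⟨d, h, t, rfl⟩)
    · rw [hv] at h
      exact ⟨G.vertexPt_mem_carrier.2 h.1, G'.vertexPt_mem_carrier.2 h.2⟩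
    · rw [he] at h
      exact ⟨G.edgePt_mem_carrier.2 (.inl h.1), G'.edgePt_mem_carrier.2 (.inl h.2)⟩
  · rintro ⟨⟨v, h, rfl⟩ | ⟨d, h, t, rfl⟩, h'⟩
    · rw [vertexPt_mem_carrier] at h' ⊢
      rw [hv]; exact ⟨h, h'⟩
    · exact hedge d t (G.edgePt_mem_carrier.2 (.inl h)) h'

end EdgeSubgraph

lemma boundary_of_squarePt_eq_edgePt {f : Y.F} {q : I × I} {d : Y.D} {t : I}
    (h : Y.squarePt f q = Y.edgePt d t) : q.1 = 0 ∨ q.1 = 1 ∨ q.2 = 0 ∨ q.2 = 1 := by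
  let G : Y.EdgeSubgraph := ⟨Set.univ, Set.univ, fun _ _ => trivial, fun _ _ => trivial⟩
  exact G.boundary_of_squarePt_mem (h ▸ G.edgePt_mem_carrier.2 (.inl trivial))


/-! ### Connected subsets of cells -/

/-- `y` lies in the connected component of `x` in `U`. -/
def Linked {E : Type*} [TopologicalSpace E] (U : Set E) (x y : E) : Prop :=
  y ∈ connectedComponentIn U x

section Linked

variable {E : Type*} [TopologicalSpace E] {U V : Set E} {x y z : E}

lemma Linked.left_mem (h : Linked U x y) : x ∈ U :=
  connectedComponentIn_nonempty_iff.1 ⟨y, h⟩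

lemma Linked.eq (h : Linked U x y) : connectedComponentIn U x = connectedComponentIn U y :=
  connectedComponentIn_eq h

lemma Linked.refl (h : x ∈ U) : Linked U x x := mem_connectedComponentIn h

lemma Linked.symm (h : Linked U x y) : Linked U y x := by
  rw [Linked, ← h.eq]; exact mem_connectedComponentIn h.left_mem

lemma Linked.trans (h : Linked U x y) (h' : Linked U y z) : Linked U x z := by
  rw [Linked, h.eq]; exact h'

lemma Linked.mono (hUV : U ⊆ V) (h : Linked U x y) : Linked V x y :=
  connectedComponentIn_mono x hUV h

lemma linked_of_eq (hy : y ∈ U)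
    (h : connectedComponentIn U x = connectedComponentIn U y) : Linked U x y := by
  rw [Linked, h]; exact mem_connectedComponentIn hy

lemma linked_of_isPreconnected {S : Set E} (hS : IsPreconnected S) (hSU : S ⊆ U) (hx : x ∈ S)
    (hy : y ∈ S) : Linked U x y := hS.subset_connectedComponentIn hx hSU hy

end Linked

lemma isPreconnected_of_Ioo_subset {S : Set I} (h : Set.Ioo 0 1 ⊆ S) : IsPreconnected S := by
  refine isPreconnected_Ioo.subset_closure h ?_
  rw [closure_Ioo zero_ne_one]
  exact fun x _ => ⟨nonneg', le_one'⟩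

lemma closure_openSquare :
    closure ((Set.Ioo 0 1 : Set I) ×ˢ (Set.Ioo 0 1 : Set I)) = Set.univ := by
  rw [closure_prod_eq, closure_Ioo zero_ne_one]
  exact Set.eq_univ_of_forall fun x => ⟨⟨nonneg', le_one'⟩, ⟨nonneg', le_one'⟩⟩

lemma isPreconnected_of_openSquare_subset {S : Set (I × I)}
    (h : (Set.Ioo 0 1 : Set I) ×ˢ (Set.Ioo 0 1 : Set I) ⊆ S) : IsPreconnected S := by
  refine (isPreconnected_Ioo.prod isPreconnected_Ioo).subset_closure h ?_
  rw [closure_openSquare]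
  exact Set.subset_univ _

/-- The set `M` contains no point of an open square. -/
def MissesOpenSquares (M : Set Y.Realization) : Prop :=
  ∀ f q, q ∈ (Set.Ioo 0 1 : Set I) ×ˢ (Set.Ioo 0 1 : Set I) → Y.squarePt f q ∉ M

lemma EdgeSubgraph.missesOpenSquares (G : Y.EdgeSubgraph) : MissesOpenSquares G.carrier := by
  intro f q hq h
  obtain ⟨⟨h1, h2⟩, h3, h4⟩ := hq
  rcases G.boundary_of_squarePt_mem h with h | h | h | h
  exacts [h1.ne' h, h2.ne h, h3.ne' h, h4.ne h]

/-- A closed square remains connected after removing a part of its boundary. -/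
lemma linked_square {M : Set Y.Realization} (hM : MissesOpenSquares M) (f : Y.F) {q q' : I × I}
    (hq : Y.squarePt f q ∉ M) (hq' : Y.squarePt f q' ∉ M) :
    Linked Mᶜ (Y.squarePt f q) (Y.squarePt f q') := by
  refine linked_of_isPreconnected (S := Y.squarePt f '' {q | Y.squarePt f q ∉ M}) ?_ ?_
    ⟨q, hq, rfl⟩ ⟨q', hq', rfl⟩
  · exact (isPreconnected_of_openSquare_subset fun q hq => hM f q hq).image _
      (continuous_squarePt f).continuousOn
  · rintro _ ⟨q, hq, rfl⟩; exact hq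

/-- An edge not in a subgraph remains connected after removing the subgraph. -/
lemma EdgeSubgraph.linked_edge (G : Y.EdgeSubgraph) {d : Y.D} (hd : d ∉ G.edges) {s t : I}
    (hs : Y.edgePt d s ∉ G.carrier) (ht : Y.edgePt d t ∉ G.carrier) :
    Linked G.carrierᶜ (Y.edgePt d s) (Y.edgePt d t) := by
  refine linked_of_isPreconnected (S := Y.edgePt d '' {t | Y.edgePt d t ∉ G.carrier}) ?_ ?_
    ⟨s, hs, rfl⟩ ⟨t, ht, rfl⟩
  · refine (isPreconnected_of_Ioo_subset (S := {t | Y.edgePt d t ∉ G.carrier})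
      fun t ht h => ?_).image _
      (continuous_edgePt d).continuousOn
    rcases G.edgePt_mem_carrier.1 h with h | ⟨h, -⟩ | ⟨h, -⟩
    exacts [hd h, ht.1.ne' h, ht.2.ne h]
  · rintro _ ⟨q, hq, rfl⟩; exact hq

/-! ### Quarter cells and the regular sphere -/

/-- The point `1/4` of the unit interval. -/
noncomputable def quarter : I := ⟨1 / 4, by norm_num, by norm_num⟩

lemma quarter_pos : (0 : I) < quarter := Subtype.coe_lt_coe.1 (by norm_num [quarter])

lemma quarter_lt_one : quarter < (1 : I) := Subtype.coe_lt_coe.1 (by norm_num [quarter])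

/-- The point at distance `1/4` from the start of an oriented edge. -/
noncomputable def quarterPt (Y : VHComplex) (d : Y.D) : Y.Realization := Y.edgePt d quarter

lemma EdgeSubgraph.quarterPt_mem_carrier (G : Y.EdgeSubgraph) {d : Y.D} :
    Y.quarterPt d ∈ G.carrier ↔ d ∈ G.edges := by
  rw [quarterPt, G.edgePt_mem_carrier]
  have h0 := quarter_pos.ne'
  have h1 := quarter_lt_one.ne
  tauto

/-- Two points of the unit interval lie in a common quarter cell. -/
def Near (s t : I) : Prop := ∃ J, IsQuarterCell J ∧ s ∈ J ∧ t ∈ J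

lemma IsQuarterCell.isPreconnected {J : Set I} (hJ : IsQuarterCell J) : IsPreconnected J := by
  suffices J.OrdConnected from this.isPreconnected
  constructor
  rcases hJ with ⟨i, -, rfl⟩ | ⟨i, -, rfl⟩
  · rintro x hx y hy z ⟨hz1, hz2⟩
    have h1 : (x : ℝ) ≤ z := hz1
    have h2 : (z : ℝ) ≤ y := hz2
    simp only [Set.mem_ofPred_eq] at hx hy ⊢
    linarith
  · rintro x hx y hy z ⟨hz1, hz2⟩
    have h1 : (x : ℝ) ≤ z := hz1
    have h2 : (z : ℝ) ≤ y := hz2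
    simp only [Set.mem_ofPred_eq] at hx hy ⊢
    constructor <;> linarith

lemma isQuarterCell_Icc_zero : IsQuarterCell (Set.Icc 0 quarter) := by
  refine .inr ⟨0, by norm_num, ?_⟩
  ext t
  simp only [Set.mem_Icc, ← Subtype.coe_le_coe, quarter, Set.mem_ofPred_eq]
  norm_num

lemma isQuarterCell_quarter : IsQuarterCell {quarter} := by
  refine .inl ⟨1, by norm_num, ?_⟩
  ext t
  simp only [Set.mem_singleton_iff, Subtype.ext_iff, quarter, Set.mem_ofPred_eq]
  norm_num

lemma exists_isQuarterCell (t : I) : ∃ J, IsQuarterCell J ∧ t ∈ J := by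
  by_cases h : (t : ℝ) = 1
  · exact ⟨_, .inl ⟨4, le_rfl, rfl⟩, by
      simp only [Set.mem_ofPred_eq, h]; norm_num⟩
  · have h1 : (t : ℝ) < 1 := lt_of_le_of_ne t.2.2 h
    have h0 : 0 ≤ 4 * (t : ℝ) := by linarith [t.2.1]
    refine ⟨_, .inr ⟨⌊4 * (t : ℝ)⌋₊, ?_, rfl⟩, ?_, ?_⟩
    · rw [Nat.floor_lt h0]; push_cast; linarith
    · have := Nat.floor_le h0; linarith
    · have := Nat.lt_floor_add_one (4 * (t : ℝ)); linarith

lemma IsQuarterCell.preimage_symm {J : Set I} (hJ : IsQuarterCell J) : IsQuarterCell (σ ⁻¹' J) := by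
  rcases hJ with ⟨i, hi, rfl⟩ | ⟨i, hi, rfl⟩
  · refine .inl ⟨4 - i, by omega, ?_⟩
    ext t
    simp only [Set.mem_preimage, Set.mem_ofPred_eq, coe_symm_eq]
    rw [Nat.cast_sub hi]
    push_cast
    constructor <;> intro h <;> linarith
  · refine .inr ⟨3 - i, by omega, ?_⟩
    ext t
    simp only [Set.mem_preimage, Set.mem_ofPred_eq, coe_symm_eq]
    rw [Nat.cast_sub (by omega)]
    push_cast
    constructor <;> rintro ⟨h, h'⟩ <;> constructor <;> linarith

lemma Near.map_symm {s t : I} (h : Near s t) : Near (σ s) (σ t) := by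
  obtain ⟨J, hJ, hs, ht⟩ := h
  exact ⟨_, hJ.preimage_symm, by simpa using hs, by simpa using ht⟩

lemma Near.comm {s t : I} (h : Near s t) : Near t s := by
  obtain ⟨J, hJ, hs, ht⟩ := h
  exact ⟨J, hJ, ht, hs⟩

lemma Near.le_quarter {s : I} (h : Near s 0) : s ≤ quarter := by
  obtain ⟨J, hJ, hs, h0⟩ := h
  rw [← Subtype.coe_le_coe]
  simp only [quarter]
  rcases hJ with ⟨i, hi, rfl⟩ | ⟨i, hi, rfl⟩
  · simp only [Set.mem_ofPred_eq] at hs h0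
    rw [hs, ← h0]; norm_num
  · simp only [Set.mem_ofPred_eq] at hs h0
    have : (i : ℝ) ≤ 0 := by have := h0.1; simp at this; linarith
    linarith [hs.2]

lemma not_near_one_zero : ¬ Near 1 0 := fun h =>
  absurd quarter_lt_one (Near.le_quarter h).not_gt

lemma IsQuarterCell.zero_mem {J : Set I} (hJ : IsQuarterCell J) {s : I} (hs : s ∈ J) (h0 : 0 < s)
    (h1 : s < quarter) : 0 ∈ J := by
  rw [← Subtype.coe_lt_coe] at h0 h1
  simp only [quarter] at h1
  simp only [Set.Icc.coe_zero] at h0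
  rcases hJ with ⟨i, hi, rfl⟩ | ⟨i, hi, rfl⟩
  · simp only [Set.mem_ofPred_eq] at hs
    have h2 : (0 : ℝ) < i := by linarith
    have h3 : (i : ℝ) < 1 := by linarith
    norm_cast at h2 h3
    omega
  · simp only [Set.mem_ofPred_eq] at hs ⊢
    have h3 : (i : ℝ) < 1 := by linarith
    norm_cast at h3
    obtain rfl : i = 0 := by omega
    simp

lemma IsQuarterCell.one_mem {J : Set I} (hJ : IsQuarterCell J) {s : I} (hs : σ s ∈ J) (h0 : 0 < s)
    (h1 : s < quarter) : 1 ∈ J := by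
  have := hJ.preimage_symm.zero_mem hs h0 h1
  simpa using this

/-- A subdivided cell with a point strictly between `0` and `1/4` on an edge contains the start of
the edge. -/
lemma IsSubdividedCell.src_mem {c : Set Y.Realization} (hc : Y.IsSubdividedCell c) {d : Y.D} {s : I}
    (hs : Y.edgePt d s ∈ c) (h0 : 0 < s) (h1 : s < quarter) : Y.vertexPt (Y.src d) ∈ c := by
  have hs0 := h0.ne'
  have hs1 := (h1.trans quarter_lt_one).ne
  rw [← edgePt_zero]
  rcases hc with ⟨v, rfl⟩ | ⟨d', J, hJ, rfl⟩ | ⟨f, J, K, hJ, hK, rfl⟩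
  · exfalso
    have h : Y.edgePt d s = Y.vertexPt v := hs
    let G : Y.EdgeSubgraph := ⟨{v}, ∅, by simp, by simp⟩
    have := G.edgePt_mem_carrier.1 (h ▸ G.vertexPt_mem_carrier.2 rfl)
    simp [G, hs0, hs1] at this
  · obtain ⟨t, ht, hts⟩ := hs
    rcases eq_of_edgePt_eq hs0 hs1 hts with ⟨rfl, rfl⟩ | ⟨rfl, rfl⟩
    · exact ⟨0, hJ.zero_mem ht h0 h1, rfl⟩
    · exact ⟨1, hJ.one_mem ht h0 h1, by rw [edgePt_inv, symm_one]⟩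
  · obtain ⟨⟨x, y⟩, ⟨hx, hy⟩, hq⟩ := hs
    simp only at hx hy
    -- on each of the four sides of the square the argument is the same
    have key : ∀ (d' : Y.D) (t : I) (J : Set I), IsQuarterCell J → t ∈ J →
        Y.edgePt d' t = Y.edgePt d s → ∃ u ∈ J, Y.edgePt d' u = Y.edgePt d 0 := by
      intro d' t J hJ ht hts
      rcases eq_of_edgePt_eq hs0 hs1 hts with ⟨rfl, rfl⟩ | ⟨rfl, rfl⟩
      · exact ⟨0, hJ.zero_mem ht h0 h1, rfl⟩
      · exact ⟨1, hJ.one_mem ht h0 h1, by rw [edgePt_inv, symm_one]⟩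
    rcases boundary_of_squarePt_eq_edgePt hq with h | h | h | h <;> simp only at h <;> subst h
    · rw [squarePt_left] at hq
      obtain ⟨u, hu, h⟩ := key _ _ K hK hy hq
      exact ⟨(0, u), ⟨hx, hu⟩, by rw [squarePt_left, h]⟩
    · rw [squarePt_right] at hq
      obtain ⟨u, hu, h⟩ := key _ _ K hK hy hq
      exact ⟨(1, u), ⟨hx, hu⟩, by rw [squarePt_right, h]⟩
    · rw [squarePt_bottom] at hq
      obtain ⟨u, hu, h⟩ := key _ _ J hJ hx hq
      exact ⟨(u, 0), ⟨hu, hy⟩, by rw [squarePt_bottom, h]⟩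
    · rw [squarePt_top] at hq
      obtain ⟨u, hu, h⟩ := key _ _ J hJ hx hq
      exact ⟨(u, 1), ⟨hu, hy⟩, by rw [squarePt_top, h]⟩

/-- The point `x` lies on an edge which starts at a vertex of `G` without belonging to `G`, at
distance at most `1/4` from that vertex and distinct from it. -/
def EdgeSubgraph.Close (G : Y.EdgeSubgraph) (x : Y.Realization) : Prop :=
  ∃ d t, Y.src d ∈ G.verts ∧ d ∉ G.edges ∧ 0 < t ∧ t ≤ quarter ∧ x = Y.edgePt d t

/-- A point of an edge outside `G` in the same quarter cell as a point of `G`. -/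
lemma EdgeSubgraph.close_of_near_edge (G : Y.EdgeSubgraph) {d : Y.D} {s t : I} (hst : Near s t)
    (hs : Y.edgePt d s ∉ G.carrier) (ht : Y.edgePt d t ∈ G.carrier) : G.Close (Y.edgePt d s) := by
  have hd : d ∉ G.edges := fun h => hs (G.edgePt_mem_carrier.2 (.inl h))
  rcases G.edgePt_mem_carrier.1 ht with h | ⟨rfl, h⟩ | ⟨rfl, h⟩
  · exact absurd h hd
  · refine ⟨d, s, h, hd, ?_, hst.le_quarter, rfl⟩
    refine lt_of_le_of_ne nonneg' ?_
    rintro rfl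
    exact hs ht
  · refine ⟨Y.inv d, σ s, h, fun h => hd (G.inv_mem_iff.1 h), ?_, ?_, ?_⟩
    · refine lt_of_le_of_ne nonneg' fun h => hs ?_
      rw [symm_eq_zero.1 h.symm]
      exact ht
    · have := hst.map_symm
      rw [symm_one] at this
      exact this.le_quarter
    · rw [edgePt_inv, symm_symm]

/-- A boundary point of a square outside `G` in the same subdivided square as a point of `G` on the
left side. -/
lemma EdgeSubgraph.close_of_near_left (G : Y.EdgeSubgraph) {f : Y.F} {x y y₀ : I} (hx : Near x 0)
    (hy : Near y y₀) (hb : x = 0 ∨ x = 1 ∨ y = 0 ∨ y = 1)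
    (h : Y.squarePt f (x, y) ∉ G.carrier) (h₀ : Y.squarePt f (0, y₀) ∈ G.carrier) :
    G.Close (Y.squarePt f (x, y)) := by
  -- reduction to the bottom side by symmetry
  wlog hb' : x = 0 ∨ y = 0 generalizing f y y₀ with H
  · have hx1 : x ≠ 1 := fun h => by
      have := hx.le_quarter; rw [h] at this; exact absurd quarter_lt_one this.not_gt
    have hy1 : y = 1 := by tauto
    have h' := H (f := Y.flipV f) (y := σ y) (y₀ := σ y₀) hy.map_symm
      (.inr (.inr (.inl (symm_eq_zero.2 hy1))))
    simp only [squarePt_flipV, symm_symm] at h'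
    exact h' h h₀ (.inr (symm_eq_zero.2 hy1))
  rw [squarePt_left] at h₀
  rcases hb' with rfl | rfl
  · rw [squarePt_left] at h ⊢
    exact G.close_of_near_edge hy h h₀
  · rw [squarePt_bottom] at h ⊢
    have hx0 : 0 < x := by
      refine lt_of_le_of_ne nonneg' ?_
      rintro rfl
      rcases G.edgePt_mem_carrier.1 h₀ with h' | ⟨rfl, h'⟩ | ⟨rfl, h'⟩
      · exact h (G.edgePt_mem_carrier.2 (.inr (.inl ⟨rfl, Y.src_vside f ▸ G.src_mem _ h'⟩)))
      · exact h (G.edgePt_mem_carrier.2 (.inr (.inl ⟨rfl, Y.src_vside f ▸ h'⟩)))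
      · exact not_near_one_zero hy.comm
    refine ⟨_, x, ?_, fun h' => h (G.edgePt_mem_carrier.2 (.inl h')), hx0, hx.le_quarter, rfl⟩
    rw [← Y.src_vside]
    rcases G.edgePt_mem_carrier.1 h₀ with h' | ⟨rfl, h'⟩ | ⟨rfl, h'⟩
    · exact G.src_mem _ h'
    · exact h'
    · exact absurd hy.comm not_near_one_zero


lemma near_refl (t : I) : Near t t := by
  obtain ⟨J, hJ, ht⟩ := exists_isQuarterCell t
  exact ⟨J, hJ, ht, ht⟩

/-- A boundary point of a square outside `G` in the same subdivided square as a point of `G`. -/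
lemma EdgeSubgraph.close_of_near_square (G : Y.EdgeSubgraph) {f : Y.F} {x y x₀ y₀ : I}
    (hx : Near x x₀) (hy : Near y y₀) (hb : x = 0 ∨ x = 1 ∨ y = 0 ∨ y = 1)
    (h : Y.squarePt f (x, y) ∉ G.carrier) (h₀ : Y.squarePt f (x₀, y₀) ∈ G.carrier) :
    G.Close (Y.squarePt f (x, y)) := by
  have left : ∀ {f : Y.F} {x y x₀ y₀ : I}, Near x x₀ → Near y y₀ →
      (x = 0 ∨ x = 1 ∨ y = 0 ∨ y = 1) → Y.squarePt f (x, y) ∉ G.carrier →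
      Y.squarePt f (x₀, y₀) ∈ G.carrier → x₀ = 0 ∨ x₀ = 1 → G.Close (Y.squarePt f (x, y)) := by
    rintro f x y x₀ y₀ hx hy hb h h₀ (rfl | rfl)
    · exact G.close_of_near_left hx hy hb h h₀
    · have hx' := hx.map_symm
      rw [symm_one] at hx'
      have := G.close_of_near_left (f := Y.flipH f) hx' hy
        (by rw [symm_eq_zero, symm_eq_one]; tauto)
        (by rwa [squarePt_flipH, symm_symm]) (by rwa [squarePt_flipH, symm_zero])
      rwa [squarePt_flipH, symm_symm] at this
  have bottom : ∀ {f : Y.F} {x y x₀ : I}, Near x x₀ → Near y 0 →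
      (x = 0 ∨ x = 1 ∨ y = 0 ∨ y = 1) → Y.squarePt f (x, y) ∉ G.carrier →
      Y.squarePt f (x₀, 0) ∈ G.carrier → G.Close (Y.squarePt f (x, y)) := by
    intro f x y x₀ hx hy hb h h₀
    by_cases hx₀ : x₀ = 0 ∨ x₀ = 1
    · exact left hx hy hb h h₀ hx₀
    have hf : Y.hside f ∈ G.edges := by
      rw [squarePt_bottom] at h₀
      have := G.edgePt_mem_carrier.1 h₀
      tauto
    have hbot : ∀ t, Y.squarePt f (t, 0) ∈ G.carrier := fun t => by
      rw [squarePt_bottom]; exact G.edgePt_mem_carrier.2 (.inl hf)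
    have hy0 : y ≠ 0 := by rintro rfl; exact h (hbot x)
    have hy1 : y ≠ 1 := by rintro rfl; exact not_near_one_zero hy
    exact left (near_refl x) hy hb h (hbot x) (by tauto)
  rcases G.boundary_of_squarePt_mem h₀ with h' | h' | h' | h' <;> simp only at h'
  · exact left hx hy hb h h₀ (.inl h')
  · exact left hx hy hb h h₀ (.inr h')
  · subst h'
    exact bottom hx hy hb h h₀
  · subst h'
    have hy' := hy.map_symm
    rw [symm_one] at hy'
    have := bottom (f := Y.flipV f) hx hy'
      (by rw [symm_eq_zero, symm_eq_one]; tauto)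
      (by rwa [squarePt_flipV, symm_symm]) (by rwa [squarePt_flipV, symm_zero])
    rwa [squarePt_flipV, symm_symm] at this

/-- The regular sphere of a subgraph `G` meets another subgraph `M` only in points at distance `1/4`
from `G` on edges of `M` leaving `G`. -/
lemma EdgeSubgraph.eq_quarterPt_of_mem_regularSphere (G M : Y.EdgeSubgraph) {x : Y.Realization}
    (hx : x ∈ Y.regularSphere G.carrier) (hxM : x ∈ M.carrier) :
    ∃ d ∈ M.edges, Y.src d ∈ G.verts ∧ d ∉ G.edges ∧ x = Y.quarterPt d := by
  obtain ⟨c, ⟨⟨hc, c', hc', ⟨z, hzc, hzG⟩, hcc'⟩, hcG⟩, hxc⟩ := hx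
  have hxG : x ∉ G.carrier := Set.disjoint_left.1 hcG hxc
  have hclose : G.Close x := by
    have hxc' := hcc' hxc
    rcases hc' with ⟨v, rfl⟩ | ⟨d, J, hJ, rfl⟩ | ⟨f, J, K, hJ, hK, rfl⟩
    · obtain rfl : x = Y.vertexPt v := hxc'
      obtain rfl : z = Y.vertexPt v := hzc
      exact absurd hzG hxG
    · obtain ⟨s, hs, rfl⟩ := hxc'
      obtain ⟨t, ht, rfl⟩ := hzc
      exact G.close_of_near_edge ⟨J, hJ, hs, ht⟩ hxG hzG
    · obtain ⟨⟨x, y⟩, ⟨hx, hy⟩, rfl⟩ := hxc'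
      obtain ⟨⟨x₀, y₀⟩, ⟨hx₀, hy₀⟩, rfl⟩ := hzc
      exact G.close_of_near_square ⟨J, hJ, hx, hx₀⟩ ⟨K, hK, hy, hy₀⟩
        (M.boundary_of_squarePt_mem hxM) hxG hzG
  obtain ⟨d, t, hdv, hd, ht0, ht, rfl⟩ := hclose
  obtain rfl : t = quarter := by
    by_contra hne
    exact Set.disjoint_left.1 hcG (hc.src_mem hxc ht0 (lt_of_le_of_ne ht hne))
      (G.vertexPt_mem_carrier.2 hdv)
  refine ⟨d, ?_, hdv, hd, rfl⟩
  exact M.quarterPt_mem_carrier.1 hxM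

/-! ### Arcs on the regular sphere -/

lemma image_subset_regularSphere {P : Set Y.Realization} {f : Y.F} {J K J' K' : Set I}
    (hJ : IsQuarterCell J) (hK : IsQuarterCell K) (hJ' : IsQuarterCell J') (hK' : IsQuarterCell K')
    (hJJ' : J ⊆ J') (hKK' : K ⊆ K') {q : I × I} (hq : q ∈ J' ×ˢ K') (hqP : Y.squarePt f q ∈ P)
    (hP : ∀ q ∈ J ×ˢ K, Y.squarePt f q ∉ P) :
    Y.squarePt f '' (J ×ˢ K) ⊆ Y.regularSphere P := by
  intro x hx
  refine ⟨_, ⟨⟨.inr (.inr ⟨f, J, K, hJ, hK, rfl⟩), Y.squarePt f '' (J' ×ˢ K'),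
    .inr (.inr ⟨f, J', K', hJ', hK', rfl⟩), ⟨_, ⟨q, hq, rfl⟩, hqP⟩,
    Set.image_mono (Set.prod_mono hJJ' hKK')⟩, ?_⟩, hx⟩
  rw [Set.disjoint_left]
  rintro _ ⟨q, hq, rfl⟩
  exact hP q hq

lemma EdgeSubgraph.quarterPt_mem_regularSphere (G : Y.EdgeSubgraph) {d : Y.D}
    (hd : Y.src d ∈ G.verts) (hd' : d ∉ G.edges) : Y.quarterPt d ∈ Y.regularSphere G.carrier := by
  refine ⟨Y.edgePt d '' {quarter}, ⟨⟨.inr (.inl ⟨d, _, isQuarterCell_quarter, rfl⟩),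
    Y.edgePt d '' Set.Icc 0 quarter, .inr (.inl ⟨d, _, isQuarterCell_Icc_zero, rfl⟩),
    ⟨_, ⟨0, ⟨le_rfl, quarter_pos.le⟩, rfl⟩, ?_⟩, Set.image_mono ?_⟩, ?_⟩, quarter, rfl, rfl⟩
  · rw [edgePt_zero]; exact G.vertexPt_mem_carrier.2 hd
  · rintro _ rfl; exact ⟨quarter_pos.le, le_rfl⟩
  · rw [Set.disjoint_left]
    rintro _ ⟨_, rfl, rfl⟩ h
    exact hd' (G.quarterPt_mem_carrier.1 h)

/-- Points of the arcs of the regular sphere around a corner. -/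
lemma squarePt_not_mem_of_corner {M : Set Y.Realization} (hM : MissesOpenSquares M) {f : Y.F}
    (hv : Y.quarterPt (Y.vside f) ∉ M) (hh : Y.quarterPt (Y.hside f) ∉ M) (t : I) (ht : t ≤ quarter) :
    Y.squarePt f (quarter, t) ∉ M ∧ Y.squarePt f (t, quarter) ∉ M := by
  have hI : quarter ∈ (Set.Ioo 0 1 : Set I) := ⟨quarter_pos, quarter_lt_one⟩
  by_cases h0 : t = 0
  · subst h0
    rw [squarePt_bottom, squarePt_left]
    exact ⟨hh, hv⟩
  · have htI : t ∈ (Set.Ioo 0 1 : Set I) :=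
      ⟨lt_of_le_of_ne nonneg' (Ne.symm h0), ht.trans_lt quarter_lt_one⟩
    exact ⟨hM f _ ⟨hI, htI⟩, hM f _ ⟨htI, hI⟩⟩

lemma EdgeSubgraph.linked_of_corner (G : Y.EdgeSubgraph) {M : Set Y.Realization}
    (hM : MissesOpenSquares M) {d e : Y.D} (h : Y.Corner d e) (hdv : Y.src d ∈ G.verts)
    (hd : d ∉ G.edges) (he : e ∉ G.edges) (hdM : Y.quarterPt d ∉ M) (heM : Y.quarterPt e ∉ M) :
    Linked (Y.regularSphere G.carrier \ M) (Y.quarterPt d) (Y.quarterPt e) := by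
  have key : ∀ f, Y.src (Y.vside f) ∈ G.verts → Y.vside f ∉ G.edges → Y.hside f ∉ G.edges →
      Y.quarterPt (Y.vside f) ∉ M → Y.quarterPt (Y.hside f) ∉ M →
      Linked (Y.regularSphere G.carrier \ M) (Y.quarterPt (Y.vside f)) (Y.quarterPt (Y.hside f)) := by
    intro f hsrc hv hh hvM hhM
    have hout := squarePt_not_mem_of_corner hM hvM hhM
    have hoG := squarePt_not_mem_of_corner G.missesOpenSquares
      (mt G.quarterPt_mem_carrier.1 hv) (mt G.quarterPt_mem_carrier.1 hh)
    have h00 : ((0 : I), (0 : I)) ∈ Set.Icc (0 : I) quarter ×ˢ Set.Icc (0 : I) quarter :=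
      ⟨⟨le_rfl, quarter_pos.le⟩, ⟨le_rfl, quarter_pos.le⟩⟩
    have h00G : Y.squarePt f (0, 0) ∈ G.carrier := by
      rw [squarePt_left, edgePt_zero]; exact G.vertexPt_mem_carrier.2 hsrc
    have hq : ({quarter} : Set I) ⊆ Set.Icc 0 quarter := by
      rintro _ rfl; exact ⟨quarter_pos.le, le_rfl⟩
    have h1 := image_subset_regularSphere isQuarterCell_quarter isQuarterCell_Icc_zero
      isQuarterCell_Icc_zero isQuarterCell_Icc_zero hq subset_rfl h00 h00G
      (by rintro ⟨_, t⟩ ⟨rfl, ht⟩; exact (hoG t ht.2).1)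
    have h2 := image_subset_regularSphere isQuarterCell_Icc_zero isQuarterCell_quarter
      isQuarterCell_Icc_zero isQuarterCell_Icc_zero subset_rfl hq h00 h00G
      (by rintro ⟨t, _⟩ ⟨ht, rfl⟩; exact (hoG t ht.2).2)
    have hc := continuous_squarePt f
    have hl1 : Linked (Y.regularSphere G.carrier \ M) (Y.squarePt f (0, quarter))
        (Y.squarePt f (quarter, quarter)) := by
      refine linked_of_isPreconnected ((isQuarterCell_Icc_zero.isPreconnected.prod
        isQuarterCell_quarter.isPreconnected).image _ hc.continuousOn) (fun x hx => ⟨h2 hx, ?_⟩)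
        ⟨(0, quarter), ⟨⟨le_rfl, quarter_pos.le⟩, rfl⟩, rfl⟩
        ⟨(quarter, quarter), ⟨⟨quarter_pos.le, le_rfl⟩, rfl⟩, rfl⟩
      obtain ⟨⟨t, _⟩, ⟨ht, rfl⟩, rfl⟩ := hx
      exact (hout t ht.2).2
    have hl2 : Linked (Y.regularSphere G.carrier \ M) (Y.squarePt f (quarter, quarter))
        (Y.squarePt f (quarter, 0)) := by
      refine linked_of_isPreconnected ((isQuarterCell_quarter.isPreconnected.prod
        isQuarterCell_Icc_zero.isPreconnected).image _ hc.continuousOn) (fun x hx => ⟨h1 hx, ?_⟩)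
        ⟨(quarter, quarter), ⟨rfl, ⟨quarter_pos.le, le_rfl⟩⟩, rfl⟩
        ⟨(quarter, 0), ⟨rfl, ⟨le_rfl, quarter_pos.le⟩⟩, rfl⟩
      obtain ⟨⟨_, t⟩, ⟨rfl, ht⟩, rfl⟩ := hx
      exact (hout t ht.2).1
    have := hl1.trans hl2
    rwa [squarePt_left, squarePt_bottom] at this
  have hsrc := h.src_eq
  obtain ⟨f, ⟨rfl, rfl⟩ | ⟨rfl, rfl⟩⟩ := h
  · exact key f hdv hd he hdM heM
  · exact (key f (hsrc ▸ hdv) he hd heM hdM).symm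

lemma EdgeSubgraph.linked_of_opp (G : Y.EdgeSubgraph) {M : Set Y.Realization}
    (hM : MissesOpenSquares M) {e d d' : Y.D} (h : Y.Opp e d d') (he : e ∈ G.edges)
    (hd : d ∉ G.edges) (hd' : d' ∉ G.edges) (hdM : Y.quarterPt d ∉ M) (hdM' : Y.quarterPt d' ∉ M) :
    Linked (Y.regularSphere G.carrier \ M) (Y.quarterPt d) (Y.quarterPt d') := by
  have hI : quarter ∈ (Set.Ioo 0 1 : Set I) := ⟨quarter_pos, quarter_lt_one⟩
  have h01 : ∀ t : I, t = 0 ∨ t = 1 ∨ t ∈ (Set.Ioo 0 1 : Set I) := fun t => by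
    by_cases h0 : t = 0
    · exact .inl h0
    by_cases h1 : t = 1
    · exact .inr (.inl h1)
    exact .inr (.inr ⟨lt_of_le_of_ne nonneg' (Ne.symm h0), lt_of_le_of_ne le_one' h1⟩)
  have hq : ({quarter} : Set I) ⊆ Set.Icc 0 quarter := by
    rintro _ rfl; exact ⟨quarter_pos.le, le_rfl⟩
  have hdG := mt G.quarterPt_mem_carrier.1 hd
  have hdG' := mt G.quarterPt_mem_carrier.1 hd'
  obtain ⟨f, ⟨rfl, rfl, rfl⟩ | ⟨rfl, rfl, rfl⟩⟩ := h
  · have hout : ∀ {N : Set Y.Realization}, MissesOpenSquares N → Y.quarterPt (Y.vside f) ∉ N →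
        Y.quarterPt (Y.vside (Y.flipH f)) ∉ N → ∀ t, Y.squarePt f (t, quarter) ∉ N := by
      intro N hN h1 h2 t
      rcases h01 t with rfl | rfl | h
      · rwa [squarePt_left]
      · rwa [squarePt_right]
      · exact hN f _ ⟨h, hI⟩
    have : Linked (Y.regularSphere G.carrier \ M) (Y.squarePt f (0, quarter))
        (Y.squarePt f (1, quarter)) := by
      refine linked_of_isPreconnected (S := Y.squarePt f '' (Set.univ ×ˢ {quarter}))
        ((isPreconnected_univ.prod isPreconnected_singleton).image _
          (continuous_squarePt f).continuousOn) ?_ ⟨_, ⟨trivial, rfl⟩, rfl⟩ ⟨_, ⟨trivial, rfl⟩, rfl⟩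
      rintro _ ⟨⟨t, _⟩, ⟨-, rfl⟩, rfl⟩
      refine ⟨?_, hout hM hdM hdM' t⟩
      obtain ⟨J, hJ, htJ⟩ := exists_isQuarterCell t
      refine image_subset_regularSphere (q := (t, 0)) hJ isQuarterCell_quarter hJ
        isQuarterCell_Icc_zero subset_rfl hq ⟨htJ, ⟨le_rfl, quarter_pos.le⟩⟩ ?_ ?_
        ⟨(t, quarter), ⟨htJ, rfl⟩, rfl⟩
      · rw [squarePt_bottom]; exact G.edgePt_mem_carrier.2 (.inl he)
      · rintro ⟨t, _⟩ ⟨-, rfl⟩; exact hout G.missesOpenSquares hdG hdG' t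
    rwa [squarePt_left, squarePt_right] at this
  · have hout : ∀ {N : Set Y.Realization}, MissesOpenSquares N → Y.quarterPt (Y.hside f) ∉ N →
        Y.quarterPt (Y.hside (Y.flipV f)) ∉ N → ∀ t, Y.squarePt f (quarter, t) ∉ N := by
      intro N hN h1 h2 t
      rcases h01 t with rfl | rfl | h
      · rwa [squarePt_bottom]
      · rwa [squarePt_top]
      · exact hN f _ ⟨hI, h⟩
    have : Linked (Y.regularSphere G.carrier \ M) (Y.squarePt f (quarter, 0))
        (Y.squarePt f (quarter, 1)) := by
      refine linked_of_isPreconnected (S := Y.squarePt f '' ({quarter} ×ˢ Set.univ))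
        ((isPreconnected_singleton.prod isPreconnected_univ).image _
          (continuous_squarePt f).continuousOn) ?_ ⟨_, ⟨rfl, trivial⟩, rfl⟩ ⟨_, ⟨rfl, trivial⟩, rfl⟩
      rintro _ ⟨⟨_, t⟩, ⟨rfl, -⟩, rfl⟩
      refine ⟨?_, hout hM hdM hdM' t⟩
      obtain ⟨J, hJ, htJ⟩ := exists_isQuarterCell t
      refine image_subset_regularSphere (q := (0, t)) isQuarterCell_quarter hJ
        isQuarterCell_Icc_zero hJ hq subset_rfl ⟨⟨le_rfl, quarter_pos.le⟩, htJ⟩ ?_ ?_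
        ⟨(quarter, t), ⟨rfl, htJ⟩, rfl⟩
      · rw [squarePt_left]; exact G.edgePt_mem_carrier.2 (.inl he)
      · rintro ⟨_, t⟩ ⟨rfl, -⟩; exact hout G.missesOpenSquares hdG hdG' t
    rwa [squarePt_bottom, squarePt_top] at this


/-! ### Straight lines -/

/-- A bi-infinite edge path through pairwise distinct vertices which never turns at a corner of a
square. -/
structure IsStraightLine (Y : VHComplex) (ℓ : ℤ → Y.D) : Prop where
  src_succ : ∀ n, Y.src (ℓ (n + 1)) = Y.tgt (ℓ n)
  inj : ∀ m n, Y.src (ℓ m) = Y.src (ℓ n) → m = n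
  not_corner : ∀ n, ¬ Y.Corner (Y.inv (ℓ n)) (ℓ (n + 1))

lemma corner_irrefl (d : Y.D) : ¬ Y.Corner d d := by
  rintro ⟨f, ⟨h, h'⟩ | ⟨h, h'⟩⟩ <;> exact vside_ne_hside f f (h.trans h'.symm)

namespace IsStraightLine

variable {ℓ : ℤ → Y.D} (hℓ : Y.IsStraightLine ℓ)

/-- The subgraph formed by a straight line. -/
def graph (hℓ : Y.IsStraightLine ℓ) : Y.EdgeSubgraph where
  verts := {v | ∃ n, v = Y.src (ℓ n)}
  edges := {d | ∃ n, d = ℓ n ∨ d = Y.inv (ℓ n)}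
  inv_mem := by
    rintro d ⟨n, rfl | rfl⟩
    exacts [⟨n, .inr rfl⟩, ⟨n, .inl (Y.inv_inv _)⟩]
  src_mem := by
    rintro d ⟨n, rfl | rfl⟩
    exacts [⟨n, rfl⟩, ⟨n + 1, (hℓ.src_succ n).symm⟩]

lemma mem_verts (n : ℤ) : Y.src (ℓ n) ∈ hℓ.graph.verts := ⟨n, rfl⟩

lemma mem_edges (n : ℤ) : ℓ n ∈ hℓ.graph.edges := ⟨n, .inl rfl⟩

include hℓ in
lemma src_inv_pred (n : ℤ) : Y.src (Y.inv (ℓ (n - 1))) = Y.src (ℓ n) := by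
  have := hℓ.src_succ (n - 1)
  rw [sub_add_cancel] at this
  exact this.symm

lemma eq_or_eq_of_src {d : Y.D} (hd : d ∈ hℓ.graph.edges) {n : ℤ} (h : Y.src d = Y.src (ℓ n)) :
    d = ℓ n ∨ d = Y.inv (ℓ (n - 1)) := by
  obtain ⟨m, rfl | rfl⟩ := hd
  · left; rw [hℓ.inj _ _ h]
  · right
    have := hℓ.inj _ _ ((hℓ.src_succ m).trans h)
    rw [← this, add_sub_cancel_right]

/-- No two oriented edges of a straight line are the sides of a corner of a square. -/
lemma noCorner {d e : Y.D} (h : Y.Corner d e) (hd : d ∈ hℓ.graph.edges) :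
    e ∉ hℓ.graph.edges := by
  intro he
  obtain ⟨n, hn⟩ := hℓ.graph.src_mem d hd
  have hc := hℓ.not_corner (n - 1)
  rw [sub_add_cancel] at hc
  have hne : d ≠ e := by rintro rfl; exact corner_irrefl _ h
  have hn' := h.src_eq.symm.trans hn
  rcases hℓ.eq_or_eq_of_src hd hn with rfl | rfl <;>
    rcases hℓ.eq_or_eq_of_src he hn' with rfl | rfl
  exacts [hne rfl, hc h.symm, hc h, hne rfl]

/-- The same line with the opposite orientation. -/
lemma rev (hℓ : Y.IsStraightLine ℓ) : Y.IsStraightLine fun n => Y.inv (ℓ (-n - 1)) where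
  src_succ n := by
    rw [hℓ.src_inv_pred, tgt, Y.inv_inv, neg_add']
  inj m n h := by
    rw [hℓ.src_inv_pred, hℓ.src_inv_pred] at h
    have := hℓ.inj _ _ h
    omega
  not_corner n h := by
    rw [Y.inv_inv] at h
    have := hℓ.not_corner (-(n + 1) - 1)
    rw [show -(n + 1) - 1 + 1 = -n - 1 by ring] at this
    exact this h.symm

/-- The same line with another origin. -/
lemma shift (hℓ : Y.IsStraightLine ℓ) (k : ℤ) : Y.IsStraightLine fun n => ℓ (n + k) where
  src_succ n := by rw [← hℓ.src_succ]; congr 2; ring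
  inj m n h := by have := hℓ.inj _ _ h; omega
  not_corner n h := by
    rw [show n + 1 + k = n + k + 1 by ring] at h
    exact hℓ.not_corner _ h

lemma graph_rev : hℓ.rev.graph = hℓ.graph := by
  simp only [graph, EdgeSubgraph.mk.injEq]
  constructor <;> ext d
  · constructor
    · rintro ⟨n, rfl⟩; exact ⟨-n, hℓ.src_inv_pred _⟩
    · rintro ⟨n, rfl⟩; exact ⟨-n, by rw [hℓ.src_inv_pred, neg_neg]⟩
  · constructor
    · rintro ⟨n, rfl | rfl⟩
      exacts [⟨_, .inr rfl⟩, ⟨_, .inl (Y.inv_inv _)⟩]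
    · rintro ⟨n, h⟩
      refine ⟨-n - 1, ?_⟩
      rw [show -(-n - 1) - 1 = n by ring, Y.inv_inv]
      exact h.symm

lemma graph_shift (k : ℤ) : (hℓ.shift k).graph = hℓ.graph := by
  simp only [graph, EdgeSubgraph.mk.injEq]
  constructor <;> ext d
  · constructor
    · rintro ⟨n, rfl⟩; exact ⟨_, rfl⟩
    · rintro ⟨n, rfl⟩; exact ⟨n - k, by rw [sub_add_cancel]⟩
  · constructor
    · rintro ⟨n, h⟩; exact ⟨_, h⟩
    · rintro ⟨n, h⟩; exact ⟨n - k, by rwa [sub_add_cancel]⟩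

end IsStraightLine

/-! ### Combinatorial lines are straight -/

lemma edgePt_congr (d : Y.D) {s t : I} (h : (s : ℝ) = t) : Y.edgePt d s = Y.edgePt d t := by
  rw [Subtype.ext h]

lemma linePt_of_mem_Ico (ℓ : ℤ → Y.D) {t : ℝ} {n : ℤ} (h : (n : ℝ) ≤ t) (h' : t < n + 1) :
    Y.linePt ℓ t = Y.edgePt (ℓ n) ⟨t - n, by linarith, by linarith⟩ := by
  have hf : ⌊t⌋ = n := Int.floor_eq_iff.2 ⟨h, h'⟩
  subst hf
  exact edgePt_congr _ rfl

lemma linePt_intCast (ℓ : ℤ → Y.D) (n : ℤ) : Y.linePt ℓ n = Y.vertexPt (Y.src (ℓ n)) := by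
  rw [linePt_of_mem_Ico ℓ le_rfl (by linarith), ← edgePt_zero]
  exact edgePt_congr _ (by simp)

lemma linePt_add {ℓ : ℤ → Y.D} (hℓ : ∀ n, Y.src (ℓ (n + 1)) = Y.tgt (ℓ n)) (n : ℤ) (t : I) :
    Y.linePt ℓ (n + t) = Y.edgePt (ℓ n) t := by
  by_cases h : (t : ℝ) = 1
  · have h1 : t = 1 := Subtype.ext h
    have h2 := linePt_intCast ℓ (n + 1)
    push_cast at h2
    rw [h, h1, h2, edgePt_one, hℓ]
  · have h1 : (t : ℝ) < 1 := lt_of_le_of_ne t.2.2 h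
    rw [linePt_of_mem_Ico ℓ (n := n) (by linarith [t.2.1]) (by linarith)]
    exact edgePt_congr _ (by simp)

lemma IsStraightLine.range_linePt {ℓ : ℤ → Y.D} (hℓ : Y.IsStraightLine ℓ) :
    Set.range (Y.linePt ℓ) = hℓ.graph.carrier := by
  ext x
  constructor
  · rintro ⟨t, rfl⟩
    exact hℓ.graph.edgePt_mem_carrier.2 (.inl (hℓ.mem_edges _))
  · rintro (⟨v, ⟨n, rfl⟩, rfl⟩ | ⟨d, ⟨n, rfl | rfl⟩, t, rfl⟩)
    · exact ⟨n, linePt_intCast ℓ n⟩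
    · exact ⟨n + t, linePt_add hℓ.src_succ n t⟩
    · exact ⟨n + (σ t : I), by rw [linePt_add hℓ.src_succ, edgePt_inv]⟩

lemma HasString.nonneg {p q : Y.Realization} {r : ℝ} (h : Y.HasString p q r) : 0 ≤ r := by
  induction h with
  | nil => exact le_rfl
  | edge d s t r _ ih => positivity
  | square f a b r _ ih => positivity

lemma cellDist_le {p q : Y.Realization} {r : ℝ} (h : Y.HasString p q r) : Y.cellDist p q ≤ r :=
  csInf_le ⟨0, fun _ h => h.nonneg⟩ h

lemma cellDist_square_le (f : Y.F) : Y.cellDist (Y.squarePt f (0, 1)) (Y.squarePt f (1, 0)) ≤ √2 := by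
  have := HasString.square (p := Y.squarePt f (0, 1)) f (0, 1) (1, 0) 0 .nil
  refine (cellDist_le this).trans_eq ?_
  norm_num

lemma cellDist_square_le' (f : Y.F) :
    Y.cellDist (Y.squarePt f (1, 0)) (Y.squarePt f (0, 1)) ≤ √2 := by
  have := HasString.square (p := Y.squarePt f (1, 0)) f (1, 0) (0, 1) 0 .nil
  refine (cellDist_le this).trans_eq ?_
  norm_num

/-- A combinatorial line does not turn at a corner of a square, since the diagonal of the square has
length `√2 < 2`. -/
lemma IsCombinatorialLine.exists_isStraightLine {L : Set Y.Realization}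
    (hL : Y.IsCombinatorialLine L) : ∃ ℓ, ∃ hℓ : Y.IsStraightLine ℓ, L = hℓ.graph.carrier ∧
      ∀ s t : ℝ, Y.cellDist (Y.linePt ℓ s) (Y.linePt ℓ t) = |s - t| := by
  obtain ⟨ℓ, h1, h2, h3, rfl⟩ := hL
  have hℓ : Y.IsStraightLine ℓ := by
    refine ⟨h1, fun m n h => ?_, fun n h => ?_⟩
    · have := h2 m n
      rw [h, SimpleGraph.dist_self, Nat.cast_zero, eq_comm, abs_eq_zero] at this
      omega
    · have hd := h3 n (n + 1 + (1 : I))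
      have h1' := linePt_add h1 (n + 1) 1
      push_cast at h1'
      have hv : Y.vertexPt (Y.src (ℓ n)) = Y.edgePt (Y.inv (ℓ n)) 1 := by
        rw [edgePt_inv, symm_one, edgePt_zero]
      have hlt : √2 < 2 := by
        rw [Real.sqrt_lt' (by norm_num)]; norm_num
      have habs : |(n : ℝ) - (n + 1 + (1 : I))| = 2 := by
        rw [show (n : ℝ) - (n + 1 + (1 : I)) = -2 by simp; ring]; norm_num
      rw [habs, linePt_intCast, hv] at hd
      have h1'' : Y.linePt ℓ (n + 1 + ((1 : I) : ℝ)) = Y.edgePt (ℓ (n + 1)) 1 := by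
        rw [← h1']; simp
      rw [h1''] at hd
      obtain ⟨f, ⟨h, h'⟩ | ⟨h, h'⟩⟩ := h
      · rw [← h, ← h', ← squarePt_left, ← squarePt_bottom] at hd
        linarith [cellDist_square_le f]
      · rw [← h, ← h', ← squarePt_left, ← squarePt_bottom] at hd
        linarith [cellDist_square_le' f]
  exact ⟨ℓ, hℓ, hℓ.range_linePt, h3⟩


/-! ### Components of the complement of a line -/

lemma EdgeSubgraph.quarterPt_linked_src (M : Y.EdgeSubgraph) {d : Y.D} (hd : Y.src d ∉ M.verts) :
    Linked M.carrierᶜ (Y.vertexPt (Y.src d)) (Y.quarterPt d) := by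
  have hd' : d ∉ M.edges := fun h => hd (M.src_mem _ h)
  rw [← edgePt_zero]
  refine M.linked_edge hd' ?_ (mt M.quarterPt_mem_carrier.1 hd')
  rwa [edgePt_zero, M.vertexPt_mem_carrier]

lemma EdgeSubgraph.quarterPt_linked_inv (M : Y.EdgeSubgraph) {d : Y.D} (hd : d ∉ M.edges) :
    Linked M.carrierᶜ (Y.quarterPt d) (Y.quarterPt (Y.inv d)) := by
  have h1 := mt M.quarterPt_mem_carrier.1 hd
  have h2 := mt M.quarterPt_mem_carrier.1 (mt M.inv_mem_iff.1 hd)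
  rw [quarterPt, edgePt_inv] at h2
  have := M.linked_edge hd h1 h2
  rwa [← edgePt_inv] at this

lemma exists_linked_of_walk (M : Y.EdgeSubgraph) {v w : Y.V} {l : List Y.D} (h : Y.IsWalk v l w)
    (hw : w ∈ M.verts) (hv : v ∉ M.verts) :
    ∃ d, Y.src d ∈ M.verts ∧ d ∉ M.edges ∧ Linked M.carrierᶜ (Y.vertexPt v) (Y.quarterPt d) := by
  induction h with
  | nil => exact absurd hw hv
  | cons d l w _ ih =>
    have hd : d ∉ M.edges := fun h => hv (M.src_mem _ h)
    have h1 := (M.quarterPt_linked_src hv).trans (M.quarterPt_linked_inv hd)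
    by_cases ht : Y.tgt d ∈ M.verts
    · exact ⟨Y.inv d, ht, mt M.inv_mem_iff.1 hd, h1⟩
    · obtain ⟨e, he, he', h⟩ := ih hw ht
      exact ⟨e, he, he', (h1.trans (M.quarterPt_linked_src ht).symm).trans h⟩

namespace IsStraightLine

variable {ℓ : ℤ → Y.D} (hℓ : Y.IsStraightLine ℓ)

/-- A point outside a straight line can be joined to the line by an edge path; its last edge shows that
the component of the point touches the line. -/
lemma exists_linked_quarterPt (hY : Y.IsConnected) {x : Y.Realization}
    (hx : x ∉ hℓ.graph.carrier) :
    ∃ d, Y.src d ∈ hℓ.graph.verts ∧ d ∉ hℓ.graph.edges ∧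
      Linked hℓ.graph.carrierᶜ x (Y.quarterPt d) := by
  have hvert : ∀ v, v ∉ hℓ.graph.verts → ∃ d, Y.src d ∈ hℓ.graph.verts ∧ d ∉ hℓ.graph.edges ∧
      Linked hℓ.graph.carrierᶜ (Y.vertexPt v) (Y.quarterPt d) := fun v hv => by
    obtain ⟨l, hl⟩ := hY.2 v (Y.src (ℓ 0))
    exact exists_linked_of_walk _ hl (hℓ.mem_verts 0) hv
  induction x using Quot.ind with
  | mk a =>
    cases a with
    | vertex v =>
      exact hvert v (mt hℓ.graph.vertexPt_mem_carrier.2 hx)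
    | edge d t =>
      change Y.edgePt d t ∉ _ at hx
      change ∃ e, _ ∧ _ ∧ Linked _ (Y.edgePt d t) _
      have hd : d ∉ hℓ.graph.edges := fun h => hx (hℓ.graph.edgePt_mem_carrier.2 (.inl h))
      have h1 := hℓ.graph.linked_edge hd hx (mt hℓ.graph.quarterPt_mem_carrier.1 hd)
      by_cases hs : Y.src d ∈ hℓ.graph.verts
      · exact ⟨d, hs, hd, h1⟩
      · obtain ⟨e, he, he', h2⟩ := hvert _ hs
        exact ⟨e, he, he', (h1.trans (hℓ.graph.quarterPt_linked_src hs).symm).trans h2⟩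
    | square f x y =>
      change Y.squarePt f (x, y) ∉ _ at hx
      change ∃ e, _ ∧ _ ∧ Linked _ (Y.squarePt f (x, y)) _
      have hsq := fun {q} h => linked_square hℓ.graph.missesOpenSquares f (q' := q) hx h
      by_cases hs : Y.src (Y.vside f) ∈ hℓ.graph.verts
      · by_cases hv : Y.vside f ∈ hℓ.graph.edges
        · have hh : Y.hside f ∉ hℓ.graph.edges := hℓ.noCorner ⟨f, .inl ⟨rfl, rfl⟩⟩ hv
          refine ⟨_, Y.src_vside f ▸ hs, hh, ?_⟩
          rw [quarterPt, ← squarePt_bottom]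
          apply hsq
          rw [squarePt_bottom]
          exact mt hℓ.graph.quarterPt_mem_carrier.1 hh
        · refine ⟨_, hs, hv, ?_⟩
          rw [quarterPt, ← squarePt_left]
          apply hsq
          rw [squarePt_left]
          exact mt hℓ.graph.quarterPt_mem_carrier.1 hv
      · obtain ⟨e, he, he', h2⟩ := hvert _ hs
        refine ⟨e, he, he', Linked.trans ?_ h2⟩
        rw [← edgePt_zero, ← squarePt_left]
        apply hsq
        rw [squarePt_left, edgePt_zero]
        exact mt hℓ.graph.vertexPt_mem_carrier.1 hs

end IsStraightLine

lemma EdgeSubgraph.linked_compl_of_corner (M : Y.EdgeSubgraph) {d e : Y.D} (h : Y.Corner d e)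
    (hd : d ∉ M.edges) (he : e ∉ M.edges) :
    Linked M.carrierᶜ (Y.quarterPt d) (Y.quarterPt e) := by
  have hd' := mt M.quarterPt_mem_carrier.1 hd
  have he' := mt M.quarterPt_mem_carrier.1 he
  obtain ⟨f, ⟨rfl, rfl⟩ | ⟨rfl, rfl⟩⟩ := h <;>
  · unfold quarterPt at *
    rw [← squarePt_left, ← squarePt_bottom] at *
    exact linked_square M.missesOpenSquares f hd' he'

lemma EdgeSubgraph.linked_compl_of_opp (M : Y.EdgeSubgraph) {d d' e : Y.D} (h : Y.Opp e d d')
    (hd : d ∉ M.edges) (hd' : d' ∉ M.edges) :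
    Linked M.carrierᶜ (Y.quarterPt d) (Y.quarterPt d') := by
  have h1 := mt M.quarterPt_mem_carrier.1 hd
  have h2 := mt M.quarterPt_mem_carrier.1 hd'
  obtain ⟨f, ⟨rfl, rfl, rfl⟩ | ⟨rfl, rfl, rfl⟩⟩ := h
  · unfold quarterPt at *
    rw [← squarePt_left f, ← squarePt_right f] at *
    exact linked_square M.missesOpenSquares f h1 h2
  · unfold quarterPt at *
    rw [← squarePt_bottom f, ← squarePt_top f] at *
    exact linked_square M.missesOpenSquares f h1 h2

/-- The closure of a component of the complement of `M` contains every side of a square which has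
another side in the component. -/
lemma EdgeSubgraph.edgePt_mem_closure_of_opp (M : Y.EdgeSubgraph) {d d' e : Y.D} (h : Y.Opp e d d')
    (hd : d ∉ M.edges) {x : Y.Realization} (hx : Linked M.carrierᶜ x (Y.quarterPt d)) (t : I) :
    Y.edgePt e t ∈ closure (connectedComponentIn M.carrierᶜ x) := by
  have h1 := mt M.quarterPt_mem_carrier.1 hd
  have key : ∀ (f : Y.F) (q : I × I), Y.squarePt f q = Y.quarterPt d → ∀ q',
      Y.squarePt f q' ∈ closure (connectedComponentIn M.carrierᶜ x) := by
    intro f q hq q'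
    have hsub : Y.squarePt f '' ((Set.Ioo 0 1 : Set I) ×ˢ (Set.Ioo 0 1 : Set I)) ⊆
        connectedComponentIn M.carrierᶜ x := by
      rintro _ ⟨u, hu, rfl⟩
      rw [← hq] at h1 hx
      exact hx.trans (linked_square M.missesOpenSquares f h1 (M.missesOpenSquares f u hu))
    refine closure_mono hsub (image_closure_subset_closure_image (continuous_squarePt f) ?_)
    rw [closure_openSquare]
    exact ⟨q', trivial, rfl⟩
  obtain ⟨f, ⟨rfl, rfl, -⟩ | ⟨rfl, rfl, -⟩⟩ := h
  · rw [← squarePt_bottom]; exact key f _ (squarePt_left f quarter) _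
  · rw [← squarePt_left]; exact key f _ (squarePt_bottom f quarter) _

namespace IsStraightLine

variable {ℓ : ℤ → Y.D} (hℓ : Y.IsStraightLine ℓ)

/-- Since the link of `src (ℓ n)` minus the incoming direction of the line is connected, every
complementary component of the line which touches the vertex contains a square at the outgoing edge
`ℓ n`. -/
lemma exists_opp_of_linked (hY : Y.LinksNoCut) {n : ℤ} {d : Y.D} (hd : d ∉ hℓ.graph.edges)
    (hdn : Y.src d = Y.src (ℓ n)) {x : Y.Realization}
    (hx : Linked hℓ.graph.carrierᶜ x (Y.quarterPt d)) :
    ∃ e e', Y.Opp (ℓ n) e e' ∧ e ∉ hℓ.graph.edges ∧ e' ∉ hℓ.graph.edges ∧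
      Linked hℓ.graph.carrierᶜ x (Y.quarterPt e) ∧
      Linked hℓ.graph.carrierᶜ x (Y.quarterPt e') := by
  have hne : ∀ {e}, e ∉ hℓ.graph.edges → e ≠ Y.inv (ℓ (n - 1)) := by
    rintro _ h rfl
    exact h (hℓ.graph.inv_mem _ (hℓ.mem_edges _))
  have hpath := hY (Y.inv (ℓ (n - 1))) d (ℓ n) hdn (hne hd) (by
    intro h
    have := hℓ.not_corner (n - 1)
    have h1 := hℓ.inj (n + 1) (n - 1) (by
      rw [hℓ.src_succ, tgt, h, Y.inv_inv])
    omega)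
  obtain ⟨u, v, huv, hu, hc, hv⟩ := hpath.exists_first_hit (T := fun e => e ∈ hℓ.graph.edges) hd
    (hℓ.mem_edges n)
  have hlink : Linked hℓ.graph.carrierᶜ x (Y.quarterPt u) ∧ Y.src u = Y.src (ℓ n) := by
    clear hu hc
    induction huv with
    | refl => exact ⟨hx, hdn⟩
    | tail _ h ih =>
      obtain ⟨⟨hc, -, -⟩, h1, h2⟩ := h
      exact ⟨ih.1.trans (hℓ.graph.linked_compl_of_corner hc h1 h2), hc.src_eq.symm.trans ih.2⟩
  have hvn : v = ℓ n :=
    (hℓ.eq_or_eq_of_src hv (hc.1.src_eq.symm.trans hlink.2)).resolve_right hc.2.2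
  subst hvn
  obtain ⟨e', he'⟩ := hc.1.exists_opp
  have he'' : e' ∉ hℓ.graph.edges :=
    hℓ.noCorner he'.corner'.symm (hℓ.graph.inv_mem _ (hℓ.mem_edges n))
  exact ⟨u, e', he', hu, he'', hlink.1,
    hlink.1.trans (hℓ.graph.linked_compl_of_opp he' hu he'')⟩

/-- A complementary component of a straight line which touches one vertex of the line touches all
later ones. -/
lemma exists_linked_of_le (hY : Y.LinksNoCut) {n m : ℤ} (hnm : n ≤ m) {x : Y.Realization}
    (h : ∃ d, Y.src d = Y.src (ℓ n) ∧ d ∉ hℓ.graph.edges ∧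
      Linked hℓ.graph.carrierᶜ x (Y.quarterPt d)) :
    ∃ d, Y.src d = Y.src (ℓ m) ∧ d ∉ hℓ.graph.edges ∧
      Linked hℓ.graph.carrierᶜ x (Y.quarterPt d) := by
  induction m, hnm using Int.leInduction with
  | base => exact h
  | succ m _ ih =>
    obtain ⟨d, hd, hd', hx⟩ := ih
    obtain ⟨e, e', ho, -, he', -, hx'⟩ := hℓ.exists_opp_of_linked hY hd' hd hx
    exact ⟨e', ho.corner'.src_eq.trans (hℓ.src_succ m).symm, he', hx'⟩

/-- Every complementary component of a straight line touches every vertex of the line. -/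
theorem exists_linked (hc : Y.IsConnected) (hY : Y.LinksNoCut) {x : Y.Realization}
    (hx : x ∉ hℓ.graph.carrier) (m : ℤ) :
    ∃ d, Y.src d = Y.src (ℓ m) ∧ d ∉ hℓ.graph.edges ∧
      Linked hℓ.graph.carrierᶜ x (Y.quarterPt d) := by
  obtain ⟨d, ⟨n, hn⟩, h⟩ := hℓ.exists_linked_quarterPt hc hx
  rcases le_total n m with hnm | hnm
  · exact hℓ.exists_linked_of_le hY hnm ⟨d, hn, h⟩
  · have := hℓ.rev.exists_linked_of_le hY (n := -n) (m := -m) (x := x) (by omega)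
    simp only [hℓ.graph_rev, hℓ.src_inv_pred, neg_neg] at this
    exact this ⟨d, hn, h⟩

/-- Every half-space of a straight line contains the line. -/
theorem carrier_subset_closure (hc : Y.IsConnected) (hY : Y.LinksNoCut) {x : Y.Realization}
    (hx : x ∉ hℓ.graph.carrier) :
    hℓ.graph.carrier ⊆ closure (connectedComponentIn hℓ.graph.carrierᶜ x) := by
  intro y hy
  rw [← hℓ.range_linePt] at hy
  obtain ⟨t, rfl⟩ := hy
  obtain ⟨d, hd, hd', hxd⟩ := hℓ.exists_linked hc hY hx ⌊t⌋
  obtain ⟨e, e', ho, he, -, hxe, -⟩ := hℓ.exists_opp_of_linked hY hd' hd hxd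
  exact hℓ.graph.edgePt_mem_closure_of_opp ho he hxe _

include hℓ in
lemma continuous_linePt : Continuous (Y.linePt ℓ) := by
  have hlf : LocallyFinite fun n : ℤ => Set.Icc (n : ℝ) (n + 1) := by
    intro t
    refine ⟨Set.Ioo (t - 1) (t + 1), Ioo_mem_nhds (by linarith) (by linarith),
      (Set.finite_Icc (⌊t⌋ - 2) (⌊t⌋ + 2)).subset ?_⟩
    rintro n ⟨s, ⟨h1, h2⟩, h3, h4⟩
    have h5 := Int.floor_le t
    have h6 := Int.lt_floor_add_one t
    constructor
    · have : (⌊t⌋ : ℝ) - 2 < n := by linarith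
      exact_mod_cast this.le
    · have : (n : ℝ) < ⌊t⌋ + 2 := by linarith
      exact_mod_cast this.le
  refine hlf.continuous ?_ (fun n => isClosed_Icc) fun n => ?_
  · exact Set.eq_univ_of_forall fun t =>
      Set.mem_iUnion.2 ⟨⌊t⌋, Int.floor_le t, (Int.lt_floor_add_one t).le⟩
  · rw [continuousOn_iff_continuous_domRestrict]
    have : (Set.Icc (n : ℝ) (n + 1)).domRestrict (Y.linePt ℓ) = fun t =>
        Y.edgePt (ℓ n) ⟨t.1 - n, by linarith [t.2.1], by linarith [t.2.2]⟩ := by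
      ext t
      rw [← linePt_add hℓ.src_succ, Set.domRestrict_apply]
      simp
    rw [this]
    exact (continuous_edgePt _).comp (by fun_prop)

end IsStraightLine


/-! ### Regular spheres of segments have no cut points -/

/-- The oriented edge `d` starts at a vertex of `G` but does not belong to `G`. -/
def EdgeSubgraph.Leaving (G : Y.EdgeSubgraph) (d : Y.D) : Prop := Y.src d ∈ G.verts ∧ d ∉ G.edges

/-- Adjacency in the combinatorial model of the regular sphere of `G`. Its vertices are the oriented
edges `d` leaving `G`, representing the points `quarterPt d`; they are joined by arcs around corners
of squares at vertices of `G`, and by arcs parallel to edges of `G`. -/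
def EdgeSubgraph.SphereAdj (G : Y.EdgeSubgraph) (d d' : Y.D) : Prop :=
  G.Leaving d ∧ G.Leaving d' ∧ (Y.Corner d d' ∨ ∃ e ∈ G.edges, Y.Opp e d d')

lemma EdgeSubgraph.SphereAdj.symm {G : Y.EdgeSubgraph} {d d' : Y.D} (h : G.SphereAdj d d') :
    G.SphereAdj d' d := by
  obtain ⟨h1, h2, h | ⟨e, he, h⟩⟩ := h
  · exact ⟨h2, h1, .inl h.symm⟩
  · exact ⟨h2, h1, .inr ⟨_, G.inv_mem _ he, h.symm⟩⟩

/-- `d` and `d'` are joined by a path on the combinatorial regular sphere avoiding `Q`. -/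
def EdgeSubgraph.SphereConn (G : Y.EdgeSubgraph) (Q : Y.D → Prop) : Y.D → Y.D → Prop :=
  Relation.ReflTransGen fun a b => G.SphereAdj a b ∧ ¬ Q a ∧ ¬ Q b

lemma EdgeSubgraph.SphereConn.symm {G : Y.EdgeSubgraph} {Q : Y.D → Prop} {d d' : Y.D}
    (h : G.SphereConn Q d d') : G.SphereConn Q d' d := by
  induction h with
  | refl => exact .refl
  | tail _ h ih => exact .head ⟨h.1.symm, h.2.2, h.2.1⟩ ih

/-- The combinatorial regular sphere is connected, and stays so after the removal of a vertex. -/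
def EdgeSubgraph.SphereNoCut (G : Y.EdgeSubgraph) : Prop :=
  ∀ z d d', G.Leaving d → G.Leaving d' → d ≠ z → d' ≠ z → G.SphereConn (· = z) d d'

lemma LinksNoCut.exists_path (hY : Y.LinksNoCut) {z d d' : Y.D} (h : Y.src d = Y.src d')
    (hd : d ≠ z) (hd' : d' ≠ z) :
    Relation.ReflTransGen (fun a b => Y.Corner a b ∧ Y.src a = Y.src d ∧ Y.src b = Y.src d ∧
      a ≠ z ∧ b ≠ z) d d' := by
  have hp := hY z d d' h hd hd'
  clear h hd'
  have : Relation.ReflTransGen (fun a b => Y.Corner a b ∧ Y.src a = Y.src d ∧ Y.src b = Y.src d ∧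
      a ≠ z ∧ b ≠ z) d d' ∧ Y.src d' = Y.src d := by
    induction hp with
    | refl => exact ⟨.refl, rfl⟩
    | tail _ h ih =>
      have := h.1.src_eq.symm.trans ih.2
      exact ⟨ih.1.tail ⟨h.1, ih.2, this, h.2⟩, this⟩
  exact this.1

namespace IsStraightLine

variable {ℓ : ℤ → Y.D} (hℓ : Y.IsStraightLine ℓ)

/-- The segment of a straight line between two of its vertices. -/
def seg (hℓ : Y.IsStraightLine ℓ) (a b : ℤ) : Y.EdgeSubgraph where
  verts := {v | ∃ n, a ≤ n ∧ n ≤ b ∧ v = Y.src (ℓ n)}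
  edges := {d | ∃ n, a ≤ n ∧ n < b ∧ (d = ℓ n ∨ d = Y.inv (ℓ n))}
  inv_mem := by
    rintro d ⟨n, h1, h2, rfl | rfl⟩
    exacts [⟨n, h1, h2, .inr rfl⟩, ⟨n, h1, h2, .inl (Y.inv_inv _)⟩]
  src_mem := by
    rintro d ⟨n, h1, h2, rfl | rfl⟩
    exacts [⟨n, h1, h2.le, rfl⟩, ⟨n + 1, by omega, by omega, (hℓ.src_succ n).symm⟩]

lemma seg_edges_subset (a b : ℤ) : (hℓ.seg a b).edges ⊆ hℓ.graph.edges := by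
  rintro d ⟨n, -, -, h⟩; exact ⟨n, h⟩

include hℓ in
lemma ne_inv (m n : ℤ) : ℓ m ≠ Y.inv (ℓ n) := by
  intro h
  have h1 := hℓ.inj m (n + 1) (by rw [h, hℓ.src_succ]; rfl)
  subst h1
  have h2 := hℓ.inj (n + 1 + 1) n (by rw [hℓ.src_succ, tgt, h, Y.inv_inv])
  omega

lemma mem_seg_edges {a b n : ℤ} : ℓ n ∈ (hℓ.seg a b).edges ↔ a ≤ n ∧ n < b := by
  constructor
  · rintro ⟨m, h1, h2, h | h⟩
    · obtain rfl := hℓ.inj _ _ (congrArg Y.src h); exact ⟨h1, h2⟩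
    · exact absurd h (hℓ.ne_inv _ _)
  · exact fun h => ⟨n, h.1, h.2, .inl rfl⟩

lemma inv_mem_seg_edges {a b n : ℤ} : Y.inv (ℓ n) ∈ (hℓ.seg a b).edges ↔ a ≤ n ∧ n < b := by
  rw [EdgeSubgraph.inv_mem_iff, hℓ.mem_seg_edges]

lemma mem_seg_verts {a b n : ℤ} : Y.src (ℓ n) ∈ (hℓ.seg a b).verts ↔ a ≤ n ∧ n ≤ b := by
  constructor
  · rintro ⟨m, h1, h2, h⟩
    obtain rfl := hℓ.inj _ _ h; exact ⟨h1, h2⟩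
  · exact fun h => ⟨n, h.1, h.2, rfl⟩

lemma leaving_seg_succ {a b : ℤ} (hab : a ≤ b) {d : Y.D} :
    (hℓ.seg a (b + 1)).Leaving d ↔ ((hℓ.seg a b).Leaving d ∧ d ≠ ℓ b) ∨
      (Y.src d = Y.src (ℓ (b + 1)) ∧ d ≠ Y.inv (ℓ b)) := by
  constructor
  · rintro ⟨⟨n, h1, h2, h⟩, hd⟩
    by_cases hn : n = b + 1
    · subst hn
      refine .inr ⟨h, ?_⟩
      rintro rfl
      exact hd (hℓ.inv_mem_seg_edges.2 ⟨hab, by omega⟩)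
    · refine .inl ⟨⟨⟨n, h1, by omega, h⟩, ?_⟩, ?_⟩
      · rintro ⟨m, h3, h4, h5⟩
        exact hd ⟨m, h3, by omega, h5⟩
      · rintro rfl
        exact hd (hℓ.mem_seg_edges.2 ⟨hab, by omega⟩)
  · rintro (⟨⟨⟨n, h1, h2, h⟩, hd⟩, hne⟩ | ⟨h, hne⟩)
    · refine ⟨⟨n, h1, by omega, h⟩, ?_⟩
      rintro ⟨m, h3, h4, h5⟩
      by_cases hm : m = b
      · subst hm
        obtain h5 := h5.resolve_left hne
        have := hℓ.inj n (m + 1) (by rw [← h, h5, hℓ.src_succ]; rfl)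
        omega
      · exact hd ⟨m, h3, by omega, h5⟩
    · refine ⟨h ▸ hℓ.mem_seg_verts.2 ⟨by omega, le_rfl⟩, ?_⟩
      rintro ⟨m, h3, h4, rfl | rfl⟩
      · have := hℓ.inj _ _ h; omega
      · have := hℓ.inj _ _ ((hℓ.src_succ m).trans h)
        obtain rfl : m = b := by omega
        exact hne rfl

/-- Splicing: the regular sphere of a segment extended by one edge `ℓ b` is obtained from that of the
segment and from the link of the new vertex by removing the vertices `ℓ b` and its inverse, and by
joining their former neighbours across the squares at `ℓ b`. -/
lemma sphereNoCut_succ (hY : Y.LinksNoCut) {a b : ℤ} (hab : a ≤ b)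
    (ih : (hℓ.seg a b).SphereNoCut) : (hℓ.seg a (b + 1)).SphereNoCut := by
  set S := hℓ.seg a b with hS
  set S' := hℓ.seg a (b + 1) with hS'
  have hleave := fun {d} => hℓ.leaving_seg_succ hab (d := d)
  rw [← hS, ← hS'] at hleave
  have heS : S.Leaving (ℓ b) := ⟨hℓ.mem_seg_verts.2 ⟨hab, le_rfl⟩,
    fun h => absurd (hℓ.mem_seg_edges.1 h).2 (lt_irrefl _)⟩
  have heS' : ℓ b ∈ S'.edges := hℓ.mem_seg_edges.2 ⟨hab, by omega⟩
  have hinv : Y.src (Y.inv (ℓ b)) = Y.src (ℓ (b + 1)) := (hℓ.src_succ b).symm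
  have hlast : Y.src (ℓ (b + 1)) ∉ S.verts := fun h => by
    have := (hℓ.mem_seg_verts.1 h).2; omega
  -- adjacencies of the old sphere away from `ℓ b` persist
  have hB : ∀ u w, S.SphereAdj u w → u ≠ ℓ b → w ≠ ℓ b → S'.SphereAdj u w := by
    rintro u w ⟨hu, hw, h⟩ hue hwe
    refine ⟨hleave.2 (.inl ⟨hu, hue⟩), hleave.2 (.inl ⟨hw, hwe⟩), h.imp_right ?_⟩
    rintro ⟨e, ⟨n, h1, h2, h3⟩, h⟩
    exact ⟨e, ⟨n, h1, by omega, h3⟩, h⟩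
  have hC : ∀ u, S.SphereAdj u (ℓ b) →
      ∃ w, Y.src w = Y.src (ℓ (b + 1)) ∧ w ≠ Y.inv (ℓ b) ∧ S'.SphereAdj u w := by
    rintro u ⟨hu, -, h⟩
    have hc : Y.Corner u (ℓ b) := by
      rcases h with h | ⟨e, he, h⟩
      · exact h
      · exact absurd (hℓ.seg_edges_subset _ _ (S.inv_mem _ he))
          (hℓ.noCorner h.corner' (hℓ.mem_edges b))
    obtain ⟨w, hw⟩ := hc.exists_opp
    have hw1 := hw.corner'.src_eq.trans hinv
    have hw2 : w ≠ Y.inv (ℓ b) := by rintro rfl; exact corner_irrefl _ hw.corner'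
    have hu' : u ≠ ℓ b := by rintro rfl; exact corner_irrefl _ hc
    exact ⟨w, hw1, hw2, hleave.2 (.inl ⟨hu, hu'⟩), hleave.2 (.inr ⟨hw1, hw2⟩), .inr ⟨_, heS', hw⟩⟩
  have hD : ∀ w, Y.Corner w (Y.inv (ℓ b)) → w ≠ Y.inv (ℓ b) →
      ∃ u, S.Leaving u ∧ u ≠ ℓ b ∧ S'.SphereAdj u w := by
    intro w hc hw
    obtain ⟨u, hu⟩ := hc.exists_opp
    have hu := hu.symm
    rw [Y.inv_inv] at hu
    have hue : u ≠ ℓ b := by rintro rfl; exact corner_irrefl _ hu.corner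
    have hul : S.Leaving u := ⟨hu.corner.src_eq ▸ heS.1, fun h =>
      hℓ.noCorner hu.corner (hℓ.seg_edges_subset _ _ h) (hℓ.mem_edges b)⟩
    exact ⟨u, hul, hue, hleave.2 (.inl ⟨hul, hue⟩), hleave.2 (.inr ⟨hc.src_eq.trans hinv, hw⟩),
      .inr ⟨_, heS', hu⟩⟩
  intro z
  -- it suffices to connect everything to a connected hub
  have hub : ∀ H : Y.D → Prop, (∀ u v, H u → H v → S'.SphereConn (· = z) u v) →
      (∀ d, S'.Leaving d → d ≠ z → ∃ u, H u ∧ S'.SphereConn (· = z) d u) →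
      ∀ d d', S'.Leaving d → S'.Leaving d' → d ≠ z → d' ≠ z → S'.SphereConn (· = z) d d' := by
    intro H hH hto d d' hd hd' hdz hdz'
    obtain ⟨u, hu, h⟩ := hto d hd hdz
    obtain ⟨u', hu', h'⟩ := hto d' hd' hdz'
    exact (h.trans (hH u u' hu hu')).trans h'.symm
  by_cases hz : z = ℓ b ∨ (Y.src z = Y.src (ℓ (b + 1)) ∧ z ≠ Y.inv (ℓ b))
  · have hzL : ∀ u, S.Leaving u → u ≠ ℓ b → u ≠ z := by
      rintro u hu hue rfl
      rcases hz with hz | ⟨hz, -⟩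
      · exact hue hz
      · exact hlast (hz ▸ hu.1)
    refine hub (fun u => S.Leaving u ∧ u ≠ ℓ b) ?_ ?_
    · rintro u v ⟨hu, hue⟩ ⟨hv, hve⟩
      exact (ih (ℓ b) u v hu hv hue hve).imp fun x y h =>
        ⟨hB x y h.1 h.2.1 h.2.2, hzL x h.1.1 h.2.1, hzL y h.1.2.1 h.2.2⟩
    · intro d hd hdz
      rcases hleave.1 hd with h | ⟨h1, h2⟩
      · exact ⟨d, h, .refl⟩
      · have hzi : Y.inv (ℓ b) ≠ z := by
          rintro rfl
          rcases hz with hz | ⟨-, hz⟩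
          exacts [Y.inv_ne _ hz, hz rfl]
        obtain ⟨u, v, huv, hu, h, rfl⟩ := (hY.exists_path (h1.trans hinv.symm) hdz hzi).exists_first_hit
          (T := fun e => e = Y.inv (ℓ b)) h2 rfl
        obtain ⟨w, hw1, hw2, hw3⟩ := hD u h.1 hu
        refine ⟨w, ⟨hw1, hw2⟩, Relation.ReflTransGen.tail (huv.imp fun x y hxy => ?_)
          ⟨hw3.symm, h.2.2.2.1, hzL w hw1 hw2⟩⟩
        obtain ⟨⟨k1, k2, k3, k4, k5⟩, k6, k7⟩ := hxy
        exact ⟨⟨hleave.2 (.inr ⟨k2.trans h1, k6⟩), hleave.2 (.inr ⟨k3.trans h1, k7⟩), .inl k1⟩, k4, k5⟩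
  · have hzR : ∀ w, Y.src w = Y.src (ℓ (b + 1)) → w ≠ Y.inv (ℓ b) → w ≠ z := by
      rintro w h1 h2 rfl
      exact hz (.inr ⟨h1, h2⟩)
    refine hub (fun w => Y.src w = Y.src (ℓ (b + 1)) ∧ w ≠ Y.inv (ℓ b)) ?_ ?_
    · rintro u v ⟨hu, hue⟩ ⟨hv, hve⟩
      refine (hY.exists_path (hu.trans hv.symm) hue hve).imp fun x y hxy => ?_
      obtain ⟨k1, k2, k3, k6, k7⟩ := hxy
      exact ⟨⟨hleave.2 (.inr ⟨k2.trans hu, k6⟩), hleave.2 (.inr ⟨k3.trans hu, k7⟩), .inl k1⟩,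
        hzR x (k2.trans hu) k6, hzR y (k3.trans hu) k7⟩
    · intro d hd hdz
      rcases hleave.1 hd with ⟨h1, h2⟩ | h
      · obtain ⟨u, v, huv, hu, h, rfl⟩ := (ih z d (ℓ b) h1 heS hdz
          (fun h => hz (.inl h.symm))).exists_first_hit (T := fun e => e = ℓ b) h2 rfl
        obtain ⟨w, hw1, hw2, hw3⟩ := hC u h.1
        refine ⟨w, ⟨hw1, hw2⟩, Relation.ReflTransGen.tail (huv.imp fun x y hxy => ?_)
          ⟨hw3, h.2.1, hzR w hw1 hw2⟩⟩
        obtain ⟨⟨k1, k4, k5⟩, k6, k7⟩ := hxy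
        exact ⟨hB x y k1 k6 k7, k4, k5⟩
      · exact ⟨d, h, .refl⟩

/-- The regular sphere of a segment has no cut vertices, by splicing vertex links one by one. -/
theorem sphereNoCut_seg (hY : Y.LinksNoCut) {a b : ℤ} (hab : a ≤ b) :
    (hℓ.seg a b).SphereNoCut := by
  induction b, hab using Int.leInduction with
  | base =>
    have hl : ∀ d, (hℓ.seg a a).Leaving d ↔ Y.src d = Y.src (ℓ a) := by
      intro d
      constructor
      · rintro ⟨⟨n, h1, h2, h⟩, -⟩
        obtain rfl : n = a := by omega
        exact h
      · refine fun h => ⟨⟨a, le_rfl, le_rfl, h⟩, ?_⟩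
        rintro ⟨n, h1, h2, -⟩
        omega
    intro z d d' hd hd' hdz hdz'
    rw [hl] at hd hd'
    refine (hY.exists_path (hd.trans hd'.symm) hdz hdz').imp fun x y hxy => ?_
    obtain ⟨k1, k2, k3, k6, k7⟩ := hxy
    exact ⟨⟨(hl x).2 (k2.trans hd), (hl y).2 (k3.trans hd), .inl k1⟩, k6, k7⟩
  | succ b hab ih => exact hℓ.sphereNoCut_succ hY hab ih

end IsStraightLine

/-- In a graph without cut vertices, if three vertices `x`, `y`, `z` lie in different components of
the complement of `{p, q}`, then `{x, y}` does not separate. -/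
lemma EdgeSubgraph.SphereNoCut.sphereConn_pair {G : Y.EdgeSubgraph} (hG : G.SphereNoCut)
    {x y z p q : Y.D} (hz : G.Leaving z) (hp : G.Leaving p)
    (hq : G.Leaving q) (hpq : p ≠ q) (hxp : x ≠ p) (hxq : x ≠ q) (hyp : y ≠ p) (hyq : y ≠ q) (hzp : z ≠ p)
    (hzq : z ≠ q)
    (hxy : ¬ G.SphereConn (fun d => d = p ∨ d = q) x y)
    (hxz : ¬ G.SphereConn (fun d => d = p ∨ d = q) x z)
    (hyz : ¬ G.SphereConn (fun d => d = p ∨ d = q) y z)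
    {d d' : Y.D} (hd : G.Leaving d) (hd' : G.Leaving d') (hdx : d ≠ x) (hdy : d ≠ y) (hdx' : d' ≠ x)
    (hdy' : d' ≠ y) : G.SphereConn (fun d => d = x ∨ d = y) d d' := by
  set K := G.SphereConn (fun d => d = p ∨ d = q) with hK
  set K' := G.SphereConn (fun d => d = x ∨ d = y) with hK'
  -- a path from `d` to `r` avoiding `c`, cut off when it first meets `p` or `q`
  have hit : ∀ d c r, G.Leaving d → G.Leaving r → d ≠ c → r ≠ c → ¬ (d = p ∨ d = q) →
      (r = p ∨ r = q) → (∀ b, K d b → b ≠ c → b ≠ x ∧ b ≠ y) →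
      ∃ v, (v = p ∨ v = q) ∧ v ≠ c ∧ K' d v := by
    intro d c r hd hr hdc hrc hdT hrT havoid
    obtain ⟨u, v, huv, hu, ⟨hadj, huc, hvc⟩, hv⟩ :=
      (hG c d r hd hr hdc hrc).exists_first_hit (T := fun d => d = p ∨ d = q) hdT hrT
    have hpath : K d u ∧ K' d u := by
      clear hadj huc hu
      induction huv with
      | refl => exact ⟨.refl, .refl⟩
      | tail _ h ih =>
        obtain ⟨⟨h1, h2, h3⟩, h4, h5⟩ := h
        have h6 := ih.1.tail ⟨h1, h4, h5⟩
        have h7 := havoid _ ih.1 h2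
        have h8 := havoid _ h6 h3
        exact ⟨h6, ih.2.tail ⟨h1, by tauto, by tauto⟩⟩
    have h7 := havoid _ hpath.1 huc
    refine ⟨v, hv, hvc, hpath.2.tail ⟨hadj, by tauto, ?_⟩⟩
    rcases hv with rfl | rfl <;> tauto
  have hzK : ∀ b, K z b → b ≠ x ∧ b ≠ y := by
    intro b hb
    constructor <;> rintro rfl
    exacts [hxz hb.symm, hyz hb.symm]
  have hzp' : K' z p := by
    obtain ⟨v, hv, hvq, h⟩ := hit z q p hz hp hzq hpq (by tauto) (.inl rfl) fun b hb _ => hzK b hb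
    rwa [hv.resolve_right hvq] at h
  have hzq' : K' z q := by
    obtain ⟨v, hv, hvp, h⟩ := hit z p q hz hq hzp hpq.symm (by tauto) (.inr rfl)
      fun b hb _ => hzK b hb
    rwa [hv.resolve_left hvp] at h
  have main : ∀ d, G.Leaving d → d ≠ x → d ≠ y → K' d z := by
    intro d hd hdx hdy
    by_cases hdT : d = p ∨ d = q
    · rcases hdT with rfl | rfl
      exacts [hzp'.symm, hzq'.symm]
    have hfin : (∃ v, (v = p ∨ v = q) ∧ K' d v) → K' d z := by
      rintro ⟨v, rfl | rfl, h⟩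
      exacts [h.trans hzp'.symm, h.trans hzq'.symm]
    apply hfin
    by_cases h1 : K d x
    · obtain ⟨v, hv, -, h⟩ := hit d x p hd hp hdx hxp.symm hdT (.inl rfl) fun b hb hbx =>
        ⟨hbx, by rintro rfl; exact hxy (h1.symm.trans hb)⟩
      exact ⟨v, hv, h⟩
    · obtain ⟨v, hv, -, h⟩ := hit d y p hd hp hdy hyp.symm hdT (.inl rfl) fun b hb hby =>
        ⟨by rintro rfl; exact h1 hb, hby⟩
      exact ⟨v, hv, h⟩
  exact (main d hd hdx hdy).trans (main d' hd' hdx' hdy').symm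


/-! ### The intersection of two straight lines -/

/-- The subpath of `ℓ` with `n` edges starting at its `i`-th vertex. -/
def subword (ℓ : ℤ → Y.D) (i : ℤ) : ℕ → List Y.D
  | 0 => []
  | n + 1 => ℓ i :: subword ℓ (i + 1) n

namespace IsStraightLine

variable {ℓ ℓ' : ℤ → Y.D} (hℓ : Y.IsStraightLine ℓ) (hℓ' : Y.IsStraightLine ℓ')

include hℓ in
lemma isWalk_subword (i : ℤ) (n : ℕ) :
    Y.IsWalk (Y.src (ℓ i)) (subword ℓ i n) (Y.src (ℓ (i + n))) := by
  induction n generalizing i with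
  | zero => simpa [subword] using IsWalk.nil _
  | succ n ih =>
    have := ih (i + 1)
    rw [hℓ.src_succ, show i + 1 + (n : ℤ) = i + (n + 1 : ℕ) by push_cast; ring] at this
    exact .cons _ _ _ this

include hℓ in
lemma reduced_subword (i : ℤ) (n : ℕ) : Y.Reduced (subword ℓ i n) := by
  induction n generalizing i with
  | zero => simp [subword, Reduced]
  | succ n ih =>
    cases n with
    | zero => simp [subword, Reduced]
    | succ n =>
      exact List.isChain_cons_cons.2
        ⟨⟨hℓ.ne_inv _ _, fun h => hℓ.not_corner i h.corner⟩, ih (i + 1)⟩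

lemma subword_eq_subword {i i' : ℤ} {n n' : ℕ} (h : subword ℓ i n = subword ℓ' i' n') :
    n = n' ∧ ∀ k : ℕ, k < n → ℓ (i + k) = ℓ' (i' + k) := by
  induction n generalizing i i' n' with
  | zero =>
    cases n' with
    | zero => simp
    | succ n' => simp [subword] at h
  | succ n ih =>
    cases n' with
    | zero => simp [subword] at h
    | succ n' =>
      simp only [subword, List.cons.injEq] at h
      obtain ⟨h1, h2⟩ := ih h.2
      refine ⟨by rw [h1], fun k hk => ?_⟩
      cases k with
      | zero => simpa using h.1
      | succ k =>
        have := h2 k (by omega)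
        rw [show i + 1 + (k : ℤ) = i + (k + 1 : ℕ) by push_cast; ring,
          show i' + 1 + (k : ℤ) = i' + (k + 1 : ℕ) by push_cast; ring] at this
        exact this

include hℓ hℓ' in
lemma eq_of_src_eq_of_le (hY : Y.CornersFaithful) (hsc : Y.IsSimplyConnected) {i j m n : ℤ}
    (hij : i ≤ j) (hmn : m ≤ n) (hi : Y.src (ℓ i) = Y.src (ℓ' m)) (hj : Y.src (ℓ j) = Y.src (ℓ' n)) :
    j - i = n - m ∧ ∀ k, i ≤ k → k < j → ℓ k = ℓ' (k + (m - i)) := by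
  obtain ⟨s, rfl⟩ := Int.le.dest hij
  obtain ⟨t, rfl⟩ := Int.le.dest hmn
  have h := eq_of_isWalk_of_reduced hY hsc (hℓ.isWalk_subword i s)
    (by rw [hi, hj]; exact hℓ'.isWalk_subword m t) (hℓ.reduced_subword i s)
    (hℓ'.reduced_subword m t)
  obtain ⟨rfl, h'⟩ := subword_eq_subword h
  refine ⟨by ring, fun k h1 h2 => ?_⟩
  obtain ⟨u, rfl⟩ := Int.le.dest h1
  have := h' u (by omega)
  rw [this]
  congr 1
  ring

include hℓ in
/-- Two straight lines through two common vertices agree in between, up to a change of origin and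
orientation of one of them. -/
lemma exists_reparam (hY : Y.CornersFaithful) (hsc : Y.IsSimplyConnected) {i j : ℤ} (hij : i ≤ j)
    (hi : Y.src (ℓ i) ∈ hℓ'.graph.verts) (hj : Y.src (ℓ j) ∈ hℓ'.graph.verts) :
    ∃ m, ∃ hm : Y.IsStraightLine m, hm.graph = hℓ'.graph ∧ (∀ k, i ≤ k → k < j → ℓ k = m k) ∧
      ∀ k, i ≤ k → k ≤ j → Y.src (ℓ k) = Y.src (m k) := by
  obtain ⟨s, hs⟩ := hi
  obtain ⟨t, ht⟩ := hj
  wlog hst : s ≤ t generalizing ℓ' s t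
  · have := this hℓ'.rev (-s) (by rw [hℓ'.src_inv_pred, neg_neg, hs]) (-t)
      (by rw [hℓ'.src_inv_pred, neg_neg, ht]) (by omega)
    rwa [hℓ'.graph_rev] at this
  obtain ⟨h1, h2⟩ := hℓ.eq_of_src_eq_of_le hℓ' hY hsc hij hst hs ht
  refine ⟨_, hℓ'.shift (s - i), hℓ'.graph_shift _, h2, fun k hk hk' => ?_⟩
  rcases hk'.lt_or_eq with h | rfl
  · exact congrArg Y.src (h2 k hk h)
  · rw [ht]; congr 2; omega

lemma mem_edges_of_mem_verts (hY : Y.CornersFaithful) (hsc : Y.IsSimplyConnected) {i j k : ℤ}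
    (hi : Y.src (ℓ i) ∈ hℓ'.graph.verts) (hj : Y.src (ℓ j) ∈ hℓ'.graph.verts) (hik : i ≤ k)
    (hkj : k < j) (hℓ : Y.IsStraightLine ℓ) : ℓ k ∈ hℓ'.graph.edges := by
  obtain ⟨m, hm, hg, h1, -⟩ := hℓ.exists_reparam hℓ' hY hsc (hik.trans hkj.le) hi hj
  rw [← hg, h1 k hik hkj]
  exact hm.mem_edges k

/-- A point of a straight line lying on another one lies between two common vertices. -/
lemma exists_verts_of_linePt_mem {t : ℝ} (h : Y.linePt ℓ t ∈ hℓ'.graph.carrier)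
    (hℓ : Y.IsStraightLine ℓ) : Y.src (ℓ ⌊t⌋) ∈ hℓ'.graph.verts ∧
      ∃ j : ℤ, t ≤ j ∧ Y.src (ℓ j) ∈ hℓ'.graph.verts := by
  rcases hℓ'.graph.edgePt_mem_carrier.1 h with h | ⟨h, h'⟩ | ⟨h, -⟩
  · refine ⟨hℓ'.graph.src_mem _ h, ⌊t⌋ + 1, ?_, ?_⟩
    · push_cast; exact (Int.lt_floor_add_one t).le
    · rw [hℓ.src_succ]; exact hℓ'.graph.tgt_mem h
  · refine ⟨h', ⌊t⌋, ?_, h'⟩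
    have h1 := congrArg Subtype.val h
    have h2 := Int.floor_add_fract t
    simp only [Set.Icc.coe_zero] at h1
    linarith
  · have h1 := congrArg Subtype.val h
    simp only [Set.Icc.coe_one] at h1
    exact absurd h1 (Int.fract_lt_one t).ne

lemma linePt_mem_of_between (hY : Y.CornersFaithful) (hsc : Y.IsSimplyConnected) {i j : ℤ} {t : ℝ}
    (hi : Y.src (ℓ i) ∈ hℓ'.graph.verts) (hj : Y.src (ℓ j) ∈ hℓ'.graph.verts) (hit : (i : ℝ) ≤ t)
    (htj : t ≤ j) (hℓ : Y.IsStraightLine ℓ) : Y.linePt ℓ t ∈ hℓ'.graph.carrier := by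
  rcases htj.lt_or_eq with h | rfl
  · refine hℓ'.graph.edgePt_mem_carrier.2 (.inl ?_)
    exact hℓ'.mem_edges_of_mem_verts hY hsc hi hj (Int.le_floor.2 hit) (Int.floor_lt.2 h) hℓ
  · rw [linePt_intCast]
    exact hℓ'.graph.vertexPt_mem_carrier.2 hj

/-- The parameters of the points of one straight line on another one form an interval. -/
lemma ordConnected_preimage (hY : Y.CornersFaithful) (hsc : Y.IsSimplyConnected)
    (hℓ : Y.IsStraightLine ℓ) : {t | Y.linePt ℓ t ∈ hℓ'.graph.carrier}.OrdConnected := by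
  constructor
  rintro s hs t ht u ⟨hu, hu'⟩
  obtain ⟨hi, -⟩ := hℓ'.exists_verts_of_linePt_mem hs hℓ
  obtain ⟨-, j, htj, hj⟩ := hℓ'.exists_verts_of_linePt_mem ht hℓ
  exact hℓ'.linePt_mem_of_between hY hsc hi hj ((Int.floor_le s).trans hu) (hu'.trans htj) hℓ

lemma seg_congr {a b : ℤ} (he : ∀ k, a ≤ k → k < b → ℓ k = ℓ' k)
    (hv : ∀ k, a ≤ k → k ≤ b → Y.src (ℓ k) = Y.src (ℓ' k)) : hℓ.seg a b = hℓ'.seg a b := by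
  simp only [seg, EdgeSubgraph.mk.injEq]
  constructor <;> ext d
  · exact exists_congr fun k => and_congr_right fun h => and_congr_right fun h' => by rw [hv k h h']
  · exact exists_congr fun k => and_congr_right fun h => and_congr_right fun h' => by rw [he k h h']

/-- If two straight lines have common vertices, but only finitely many, then they intersect in a
segment. -/
lemma exists_seg (hY : Y.CornersFaithful) (hsc : Y.IsSimplyConnected) (hℓ : Y.IsStraightLine ℓ)
    (hne : {n | Y.src (ℓ n) ∈ hℓ'.graph.verts}.Nonempty)
    (hb : BddBelow {n | Y.src (ℓ n) ∈ hℓ'.graph.verts})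
    (ha : BddAbove {n | Y.src (ℓ n) ∈ hℓ'.graph.verts}) :
    ∃ a b, a ≤ b ∧ (∀ n, Y.src (ℓ n) ∈ hℓ'.graph.verts ↔ a ≤ n ∧ n ≤ b) ∧
      ∃ m, ∃ hm : Y.IsStraightLine m, hm.graph = hℓ'.graph ∧ hm.seg a b = hℓ.seg a b ∧
        Y.src (m a) = Y.src (ℓ a) ∧
        (hℓ.seg a b).edges = hℓ.graph.edges ∩ hm.graph.edges ∧
        (hℓ.seg a b).carrier = hℓ.graph.carrier ∩ hm.graph.carrier := by
  obtain ⟨a, ha1, ha2⟩ : ∃ a, Y.src (ℓ a) ∈ hℓ'.graph.verts ∧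
      ∀ n, Y.src (ℓ n) ∈ hℓ'.graph.verts → a ≤ n := by
    obtain ⟨c, hc⟩ := hb
    obtain ⟨a, h1, h2⟩ := Int.exists_least_of_bdd ⟨c, fun z hz => hc hz⟩ hne
    exact ⟨a, h1, h2⟩
  obtain ⟨b, hb1, hb2⟩ : ∃ b, Y.src (ℓ b) ∈ hℓ'.graph.verts ∧
      ∀ n, Y.src (ℓ n) ∈ hℓ'.graph.verts → n ≤ b := by
    obtain ⟨c, hc⟩ := ha
    obtain ⟨a, h1, h2⟩ := Int.exists_greatest_of_bdd ⟨c, fun z hz => hc hz⟩ hne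
    exact ⟨a, h1, h2⟩
  have hab := ha2 b hb1
  obtain ⟨m, hm, hg, he, hv⟩ := hℓ.exists_reparam hℓ' hY hsc hab ha1 hb1
  have hmem : ∀ n, Y.src (ℓ n) ∈ hm.graph.verts ↔ a ≤ n ∧ n ≤ b := fun n =>
    ⟨fun h => ⟨ha2 n (hg ▸ h), hb2 n (hg ▸ h)⟩, fun h => ⟨n, hv n h.1 h.2⟩⟩
  have hverts : (hℓ.seg a b).verts = hℓ.graph.verts ∩ hm.graph.verts := by
    ext v
    constructor
    · rintro ⟨n, h1, h2, rfl⟩; exact ⟨hℓ.mem_verts n, (hmem n).2 ⟨h1, h2⟩⟩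
    · rintro ⟨⟨n, rfl⟩, h⟩; exact hℓ.mem_seg_verts.2 ((hmem n).1 h)
  have hedge : ∀ n, ℓ n ∈ hm.graph.edges ↔ a ≤ n ∧ n < b := by
    intro n
    constructor
    · intro h
      have h1 := (hmem n).1 (hm.graph.src_mem _ h)
      have h2 := (hmem (n + 1)).1 (by rw [hℓ.src_succ]; exact hm.graph.tgt_mem h)
      omega
    · intro h
      rw [he n h.1 h.2]
      exact hm.mem_edges n
  have hedges : (hℓ.seg a b).edges = hℓ.graph.edges ∩ hm.graph.edges := by
    ext d
    constructor
    · rintro ⟨n, h1, h2, rfl | rfl⟩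
      · exact ⟨hℓ.mem_edges n, (hedge n).2 ⟨h1, h2⟩⟩
      · exact ⟨hℓ.graph.inv_mem _ (hℓ.mem_edges n), hm.graph.inv_mem _ ((hedge n).2 ⟨h1, h2⟩)⟩
    · rintro ⟨⟨n, rfl | rfl⟩, h⟩
      · exact hℓ.mem_seg_edges.2 ((hedge n).1 h)
      · exact hℓ.inv_mem_seg_edges.2 ((hedge n).1 (hm.graph.inv_mem_iff.1 h))
  exact ⟨a, b, hab, fun n => hg ▸ hmem n, m, hm, hg, (hℓ.seg_congr hm he hv).symm,
    (hv a le_rfl hab).symm, hedges, EdgeSubgraph.carrier_inter _ _ _ hverts hedges⟩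

lemma leaving_seg_last {a b : ℤ} (hab : a ≤ b) : (hℓ.seg a b).Leaving (ℓ b) :=
  ⟨hℓ.mem_seg_verts.2 ⟨hab, le_rfl⟩, fun h => absurd (hℓ.mem_seg_edges.1 h).2 (lt_irrefl _)⟩

lemma leaving_seg_first {a b : ℤ} (hab : a ≤ b) : (hℓ.seg a b).Leaving (Y.inv (ℓ (a - 1))) := by
  refine ⟨?_, fun h => ?_⟩
  · rw [hℓ.src_inv_pred]; exact hℓ.mem_seg_verts.2 ⟨le_rfl, hab⟩
  · have := (hℓ.inv_mem_seg_edges.1 h).1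
    omega

/-- A straight line leaves each of its segments at the two ends only. -/
lemma eq_of_leaving_seg {a b : ℤ} {d : Y.D} (hd : (hℓ.seg a b).Leaving d)
    (h : d ∈ hℓ.graph.edges) : d = Y.inv (ℓ (a - 1)) ∨ d = ℓ b := by
  obtain ⟨⟨n, h1, h2, h3⟩, hd⟩ := hd
  rcases hℓ.eq_or_eq_of_src h h3 with rfl | rfl
  · rw [hℓ.mem_seg_edges] at hd
    obtain rfl : n = b := by omega
    exact .inr rfl
  · rw [hℓ.inv_mem_seg_edges] at hd
    obtain rfl : n = a := by omega
    exact .inl rfl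

end IsStraightLine

/-! ### Continuity of the intrinsic metric -/

lemma abs_cellDist_sub_le {p q q' : Y.Realization} {c : ℝ}
    (h : ∀ r, Y.HasString p q r → Y.HasString p q' (r + c))
    (h' : ∀ r, Y.HasString p q' r → Y.HasString p q (r + c)) (hc : 0 ≤ c) :
    |Y.cellDist p q - Y.cellDist p q'| ≤ c := by
  have key : ∀ {q q' : Y.Realization}, (∀ r, Y.HasString p q r → Y.HasString p q' (r + c)) →
      (∃ r, Y.HasString p q r) → Y.cellDist p q' - c ≤ Y.cellDist p q := fun h hne =>
    le_csInf hne fun r hr => by linarith [cellDist_le (h r hr)]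
  by_cases hne : ∃ r, Y.HasString p q r
  · have hne' : ∃ r, Y.HasString p q' r := hne.imp' _ h
    rw [abs_le]
    constructor <;> linarith [key h hne, key h' hne']
  · have hne' : ¬ ∃ r, Y.HasString p q' r := fun H => hne (H.imp' _ h')
    have e : {r | Y.HasString p q r} = ∅ := Set.eq_empty_of_forall_notMem fun r hr => hne ⟨r, hr⟩
    have e' : {r | Y.HasString p q' r} = ∅ := Set.eq_empty_of_forall_notMem fun r hr => hne' ⟨r, hr⟩
    rw [cellDist, cellDist, e, e']
    simpa using hc

lemma continuous_of_abs_sub_le {X : Type*} [TopologicalSpace X] {f : X → ℝ} {g : X → X → ℝ}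
    (hg : ∀ x, Continuous fun y => g y x) (hg0 : ∀ x, g x x = 0)
    (h : ∀ x y, |f x - f y| ≤ g x y) : Continuous f := by
  refine continuous_iff_continuousAt.2 fun x => ?_
  refine tendsto_iff_dist_tendsto_zero.2 (squeeze_zero (fun _ => dist_nonneg) (fun y => h y x) ?_)
  have := (hg x).tendsto x
  rwa [hg0] at this

lemma continuous_cellDist (p : Y.Realization) : Continuous (Y.cellDist p) := by
  refine continuous_sup_dom.2 ⟨continuous_iSup_dom.2 fun d => continuous_coinduced_dom.2 ?_,
    continuous_iSup_dom.2 fun f => continuous_coinduced_dom.2 ?_⟩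
  · refine continuous_of_abs_sub_le (g := fun s t : I => |(s : ℝ) - t|) (fun t => by fun_prop)
      (by simp) fun s t => abs_cellDist_sub_le (fun r hr => .edge d s t r hr) (fun r hr => ?_)
      (abs_nonneg _)
    rw [abs_sub_comm]
    exact .edge d t s r hr
  · refine continuous_of_abs_sub_le
      (g := fun a b : I × I => √(((a.1 : ℝ) - b.1) ^ 2 + ((a.2 : ℝ) - b.2) ^ 2))
      (fun b => by fun_prop) (by simp) fun a b =>
        abs_cellDist_sub_le (fun r hr => .square f a b r hr) (fun r hr => ?_) (Real.sqrt_nonneg _)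
    have := HasString.square f b a r hr
    rwa [← neg_sub (b.1 : ℝ) a.1, ← neg_sub (b.2 : ℝ) a.2, neg_sq, neg_sq]

/-- A compact set contains boundedly many vertices of a line that is isometrically embedded, because
the distance from a point is continuous for the weak topology. -/
lemma bounded_of_isCompact {ℓ : ℤ → Y.D}
    (hd : ∀ s t : ℝ, Y.cellDist (Y.linePt ℓ s) (Y.linePt ℓ t) = |s - t|) {P : Set Y.Realization}
    (hP : IsCompact P) : ∃ C : ℤ, ∀ n : ℤ, Y.vertexPt (Y.src (ℓ n)) ∈ P → -C ≤ n ∧ n ≤ C := by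
  obtain ⟨C, hC⟩ := hP.bddAbove_image (continuous_cellDist (Y.linePt ℓ 0)).continuousOn
  refine ⟨⌈C⌉, fun n hn => ?_⟩
  have h := hC ⟨_, hn, rfl⟩
  rw [← linePt_intCast, hd, zero_sub, abs_neg] at h
  have h1 : (|n| : ℤ) ≤ ⌈C⌉ := by
    have : ((|n| : ℤ) : ℝ) ≤ ⌈C⌉ := by push_cast; exact h.trans (Int.le_ceil C)
    exact_mod_cast this
  exact abs_le.1 h1


/-! ### The crossing criterion -/

lemma separatesIn_univ_iff {E : Type*} [TopologicalSpace E] {A : Set E} :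
    SeparatesIn Set.univ A Set.univ ↔ ∃ x y, x ∉ A ∧ y ∉ A ∧ ¬ Linked Aᶜ x y := by
  simp only [SeparatesIn, ← Set.compl_eq_univ_sdiff]
  constructor
  · rintro ⟨x, -, y, -, hx, hy, h⟩
    exact ⟨x, y, hx, hy, fun h' => h h'.eq⟩
  · rintro ⟨x, y, hx, hy, h⟩
    exact ⟨x, trivial, y, trivial, hx, hy, fun h' => h (linked_of_eq hy h')⟩

lemma separatesIn_inter_iff {E : Type*} [TopologicalSpace E] {S A B : Set E} :
    SeparatesIn S (A ∩ S) (B ∩ S) ↔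
      ∃ x ∈ B ∩ S, ∃ y ∈ B ∩ S, x ∉ A ∧ y ∉ A ∧ ¬ Linked (S \ A) x y := by
  have hS : S \ (A ∩ S) = S \ A := by ext; simp
  simp only [SeparatesIn, hS]
  constructor
  · rintro ⟨x, hx, y, hy, hx', hy', h⟩
    exact ⟨x, hx, y, hy, hx'.2, hy'.2, fun h' => h h'.eq⟩
  · rintro ⟨x, hx, y, hy, hx', hy', h⟩
    exact ⟨x, hx, y, hy, ⟨hx.2, hx'⟩, ⟨hy.2, hy'⟩, fun h' => h (linked_of_eq ⟨hy.2, hy'⟩ h')⟩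

/-- A point outside `A` in the closure of a component of the complement of `A` lies in the
component. -/
lemma linked_of_mem_closure {E : Type*} [TopologicalSpace E] {A : Set E} {x y : E} (hx : x ∉ A)
    (hy : y ∉ A) (h : y ∈ closure (connectedComponentIn Aᶜ x)) : Linked Aᶜ x y := by
  have hpre : IsPreconnected (insert y (connectedComponentIn Aᶜ x)) :=
    isPreconnected_connectedComponentIn.subset_closure (Set.subset_insert _ _)
      (Set.insert_subset h subset_closure)
  refine linked_of_isPreconnected hpre (Set.insert_subset hy (connectedComponentIn_subset _ _)) ?_
    (Set.mem_insert _ _)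
  exact Set.mem_insert_of_mem _ (mem_connectedComponentIn hx)

/-- A path on the combinatorial regular sphere traces a connected set on the regular sphere. -/
lemma EdgeSubgraph.SphereConn.linked {G N : Y.EdgeSubgraph} {Q : Y.D → Prop} {d d' : Y.D}
    (h : G.SphereConn Q d d') (hd : G.Leaving d) (hdN : d ∉ N.edges)
    (hQ : ∀ e, G.Leaving e → ¬ Q e → e ∉ N.edges) :
    Linked (Y.regularSphere G.carrier \ N.carrier) (Y.quarterPt d) (Y.quarterPt d') := by
  induction h with
  | refl =>
    exact Linked.refl ⟨G.quarterPt_mem_regularSphere hd.1 hd.2, mt N.quarterPt_mem_carrier.1 hdN⟩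
  | tail _ h ih =>
    obtain ⟨⟨hb, hc, h⟩, hbQ, hcQ⟩ := h
    have hbN := mt N.quarterPt_mem_carrier.1 (hQ _ hb hbQ)
    have hcN := mt N.quarterPt_mem_carrier.1 (hQ _ hc hcQ)
    refine ih.trans ?_
    rcases h with h | ⟨e, he, h⟩
    · exact G.linked_of_corner N.missesOpenSquares h hb.1 hb.2 hc.2 hbN hcN
    · exact G.linked_of_opp N.missesOpenSquares h he hb.2 hc.2 hbN hcN

namespace IsStraightLine

variable {ℓ ℓ' : ℤ → Y.D}

/-- If the complementary components of `ℓ'` meeting `ℓ` are all equal to one component, then `ℓ` lies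
in the corresponding half-space. -/
lemma not_crosses_of_linked (hc : Y.IsConnected) (hY : Y.LinksNoCut) (hℓ : Y.IsStraightLine ℓ)
    (hℓ' : Y.IsStraightLine ℓ') {w : Y.Realization} (hw : w ∉ hℓ'.graph.carrier)
    (h : ∀ x ∈ hℓ.graph.carrier, x ∉ hℓ'.graph.carrier → Linked hℓ'.graph.carrierᶜ w x) :
    ¬ Crosses hℓ.graph.carrier hℓ'.graph.carrier := by
  intro hcr
  refine hcr _ ⟨w, hw, rfl⟩ fun x hx => ?_
  by_cases hx' : x ∈ hℓ'.graph.carrier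
  · exact hℓ'.carrier_subset_closure hc hY hw hx'
  · exact subset_closure (h x hx hx')

lemma not_crosses_of_isPreconnected (hc : Y.IsConnected) (hY : Y.LinksNoCut)
    (hℓ : Y.IsStraightLine ℓ) (hℓ' : Y.IsStraightLine ℓ')
    (hsep : SeparatesIn Set.univ hℓ'.graph.carrier Set.univ)
    (h : IsPreconnected {t | Y.linePt ℓ t ∉ hℓ'.graph.carrier}) :
    ¬ Crosses hℓ.graph.carrier hℓ'.graph.carrier := by
  have hpre := h.image _ hℓ.continuous_linePt.continuousOn
  by_cases hne : {t | Y.linePt ℓ t ∉ hℓ'.graph.carrier}.Nonempty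
  · obtain ⟨s, hs⟩ := hne
    refine not_crosses_of_linked hc hY hℓ hℓ' hs fun x hx hx' => ?_
    rw [← hℓ.range_linePt] at hx
    obtain ⟨t, rfl⟩ := hx
    refine linked_of_isPreconnected hpre ?_ ⟨s, hs, rfl⟩ ⟨t, hx', rfl⟩
    rintro _ ⟨u, hu, rfl⟩
    exact hu
  · obtain ⟨w, -, hw, -⟩ := separatesIn_univ_iff.1 hsep
    refine not_crosses_of_linked hc hY hℓ hℓ' hw fun x hx hx' => ?_
    rw [← hℓ.range_linePt] at hx
    obtain ⟨t, rfl⟩ := hx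
    exact absurd ⟨t, hx'⟩ hne

/-- If `ℓ` crosses `ℓ'`, then the parameters of the intersection form a non-empty bounded set, since
otherwise the rest of `ℓ` is connected. -/
lemma bounded_of_crosses (hc : Y.IsConnected) (hY : Y.LinksNoCut)
    (hℓ : Y.IsStraightLine ℓ) (hℓ' : Y.IsStraightLine ℓ')
    (hsep : SeparatesIn Set.univ hℓ'.graph.carrier Set.univ)
    (hord : {t | Y.linePt ℓ t ∈ hℓ'.graph.carrier}.OrdConnected)
    (hcr : Crosses hℓ.graph.carrier hℓ'.graph.carrier) :
    {t | Y.linePt ℓ t ∈ hℓ'.graph.carrier}.Nonempty ∧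
      BddBelow {t | Y.linePt ℓ t ∈ hℓ'.graph.carrier} ∧
      BddAbove {t | Y.linePt ℓ t ∈ hℓ'.graph.carrier} := by
  set J := {t | Y.linePt ℓ t ∈ hℓ'.graph.carrier} with hJ
  have key : ¬ IsPreconnected Jᶜ := fun h =>
    not_crosses_of_isPreconnected hc hY hℓ hℓ' hsep h hcr
  refine ⟨?_, ?_, ?_⟩
  · by_contra hne
    rw [Set.not_nonempty_iff_eq_empty] at hne
    rw [hne, Set.compl_empty] at key
    exact key isPreconnected_univ
  · by_contra hb
    refine key (Set.OrdConnected.isPreconnected ⟨fun s hs t _ u hu huJ => hs ?_⟩)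
    obtain ⟨v, hv, hvs⟩ := not_bddBelow_iff.1 hb s
    exact hord.out hv huJ ⟨hvs.le, hu.1⟩
  · by_contra hb
    refine key (Set.OrdConnected.isPreconnected ⟨fun s _ t ht u hu huJ => ht ?_⟩)
    obtain ⟨v, hv, hvs⟩ := not_bddAbove_iff.1 hb t
    exact hord.out huJ hv ⟨hu.2, hvs.le⟩

/-- If `ℓ` crosses `ℓ'` along a segment, then `ℓ'` separates the two points of `ℓ` on the regular
sphere. -/
lemma separatesIn_of_crosses (hc : Y.IsConnected) (hY : Y.LinksNoCut)
    (hℓ : Y.IsStraightLine ℓ) (hℓ' : Y.IsStraightLine ℓ') {a b : ℤ} (hab : a ≤ b)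
    (hedges : (hℓ.seg a b).edges = hℓ.graph.edges ∩ hℓ'.graph.edges)
    (hmem : ∀ t : ℝ, (a : ℝ) ≤ t → t ≤ b → Y.linePt ℓ t ∈ hℓ'.graph.carrier)
    (hmem' : ∀ t : ℝ, Y.linePt ℓ t ∈ hℓ'.graph.carrier → (a : ℝ) ≤ t ∧ t ≤ b)
    (hcr : Crosses hℓ.graph.carrier hℓ'.graph.carrier) :
    SeparatesIn (Y.regularSphere (hℓ.seg a b).carrier)
      (hℓ'.graph.carrier ∩ Y.regularSphere (hℓ.seg a b).carrier)
      (hℓ.graph.carrier ∩ Y.regularSphere (hℓ.seg a b).carrier) := by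
  have hx := hℓ.leaving_seg_first hab
  have hy := hℓ.leaving_seg_last hab
  have hxL := hℓ.graph.inv_mem _ (hℓ.mem_edges (a - 1))
  have hyL := hℓ.mem_edges b
  have hxL' : Y.quarterPt (Y.inv (ℓ (a - 1))) ∉ hℓ'.graph.carrier := fun h =>
    hx.2 (hedges ▸ ⟨hxL, hℓ'.graph.quarterPt_mem_carrier.1 h⟩)
  have hyL' : Y.quarterPt (ℓ b) ∉ hℓ'.graph.carrier := fun h =>
    hy.2 (hedges ▸ ⟨hyL, hℓ'.graph.quarterPt_mem_carrier.1 h⟩)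
  refine separatesIn_inter_iff.2
    ⟨_, ⟨hℓ.graph.quarterPt_mem_carrier.2 hxL, EdgeSubgraph.quarterPt_mem_regularSphere _ hx.1 hx.2⟩,
      _, ⟨hℓ.graph.quarterPt_mem_carrier.2 hyL, EdgeSubgraph.quarterPt_mem_regularSphere _ hy.1 hy.2⟩,
      hxL', hyL', fun hlink => ?_⟩
  have hxy := hlink.mono (V := hℓ'.graph.carrierᶜ) fun x hx => hx.2
  refine not_crosses_of_linked hc hY hℓ hℓ' hyL' (fun z hz hz' => ?_) hcr
  rw [← hℓ.range_linePt] at hz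
  obtain ⟨t, rfl⟩ := hz
  have hq0 : (0 : ℝ) < quarter := quarter_pos
  have hq1 : (quarter : ℝ) < 1 := quarter_lt_one
  -- both rays of the line outside the segment are connected
  rcases lt_or_ge t a with ht | ht
  · refine hxy.symm.trans (linked_of_isPreconnected (isPreconnected_Iio.image _
      hℓ.continuous_linePt.continuousOn) ?_ ⟨(a - 1 : ℤ) + (σ quarter : I), ?_, ?_⟩ ⟨t, ht, rfl⟩)
    · rintro _ ⟨s, hs, rfl⟩ h
      exact absurd (hmem' s h).1 (not_le.2 hs)
    · simp only [Set.mem_Iio, coe_symm_eq]; push_cast; linarith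
    · rw [linePt_add hℓ.src_succ, ← edgePt_inv, quarterPt]
  · have ht' : (b : ℝ) < t := not_le.1 fun h => hz' (hmem t ht h)
    refine linked_of_isPreconnected (isPreconnected_Ioi.image _
      hℓ.continuous_linePt.continuousOn) ?_ ⟨b + quarter, ?_, ?_⟩ ⟨t, ht', rfl⟩
    · rintro _ ⟨s, hs, rfl⟩ h
      exact absurd (hmem' s h).2 (not_le.2 hs)
    · simp only [Set.mem_Ioi]; linarith
    · rw [linePt_add hℓ.src_succ, quarterPt]

/-- If `ℓ'` separates the two points of `ℓ` on the regular sphere of the intersection, then `ℓ`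
crosses `ℓ'`. Otherwise a third component of the regular sphere minus `ℓ'` would exist, which, in the
absence of cut points, connects everything in the complement of `ℓ`. -/
lemma crosses_of_separatesIn (hc : Y.IsConnected) (hY : Y.LinksNoCut)
    (hℓ : Y.IsStraightLine ℓ) (hℓ' : Y.IsStraightLine ℓ') {a b : ℤ} (hab : a ≤ b)
    (hseg : hℓ'.seg a b = hℓ.seg a b) (hsrc : Y.src (ℓ' a) = Y.src (ℓ a))
    (hedges : (hℓ.seg a b).edges = hℓ.graph.edges ∩ hℓ'.graph.edges)
    (hsep : SeparatesIn Set.univ hℓ.graph.carrier Set.univ)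
    (hsep' : SeparatesIn Set.univ hℓ'.graph.carrier Set.univ)
    (h : SeparatesIn (Y.regularSphere (hℓ.seg a b).carrier)
      (hℓ'.graph.carrier ∩ Y.regularSphere (hℓ.seg a b).carrier)
      (hℓ.graph.carrier ∩ Y.regularSphere (hℓ.seg a b).carrier)) :
    Crosses hℓ.graph.carrier hℓ'.graph.carrier := by
  set G := hℓ.seg a b with hG
  have hcut : G.SphereNoCut := hℓ.sphereNoCut_seg hY hab
  obtain ⟨_, ⟨hxL, hxS⟩, _, ⟨hyL, hyS⟩, hxL', hyL', hxy⟩ := separatesIn_inter_iff.1 h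
  obtain ⟨x, hxM, hxv, hxe, rfl⟩ := G.eq_quarterPt_of_mem_regularSphere _ hxS hxL
  obtain ⟨y, hyM, hyv, hye, rfl⟩ := G.eq_quarterPt_of_mem_regularSphere _ hyS hyL
  have hx : G.Leaving x := ⟨hxv, hxe⟩
  have hy : G.Leaving y := ⟨hyv, hye⟩
  have hxM' := mt hℓ'.graph.quarterPt_mem_carrier.2 hxL'
  have hyM' := mt hℓ'.graph.quarterPt_mem_carrier.2 hyL'
  rintro H ⟨w, hw, rfl⟩ hsub
  have hwx := linked_of_mem_closure hw hxL' (hsub hxL)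
  have hwy := linked_of_mem_closure hw hyL' (hsub hyL)
  -- a point of a component of the complement of `ℓ'` other than that of `w`
  obtain ⟨z₀, hz₀, hwz₀⟩ : ∃ z₀, z₀ ∉ hℓ'.graph.carrier ∧ ¬ Linked hℓ'.graph.carrierᶜ w z₀ := by
    obtain ⟨u, v, hu, hv, huv⟩ := separatesIn_univ_iff.1 hsep'
    by_cases hwu : Linked hℓ'.graph.carrierᶜ w u
    · exact ⟨v, hv, fun hwv => huv (hwu.symm.trans hwv)⟩
    · exact ⟨u, hu, hwu⟩
  obtain ⟨z, hzv, hzM', hz₀z⟩ := hℓ'.exists_linked hc hY hz₀ a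
  have hz : G.Leaving z := ⟨by rw [hzv, hsrc]; exact hℓ.mem_seg_verts.2 ⟨le_rfl, hab⟩,
    fun hh => hzM' (hedges ▸ hh).2⟩
  have hwz : ¬ Linked hℓ'.graph.carrierᶜ w (Y.quarterPt z) := fun hh => hwz₀ (hh.trans hz₀z.symm)
  -- the two ends of `ℓ'` on the regular sphere
  have hp : G.Leaving (Y.inv (ℓ' (a - 1))) := hseg ▸ hℓ'.leaving_seg_first hab
  have hq : G.Leaving (ℓ' b) := hseg ▸ hℓ'.leaving_seg_last hab
  have hpM := hℓ'.graph.inv_mem _ (hℓ'.mem_edges (a - 1))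
  have hqM := hℓ'.mem_edges b
  have hne : ∀ {d e}, d ∉ hℓ'.graph.edges → e ∈ hℓ'.graph.edges → d ≠ e := by
    rintro d _ hd he rfl
    exact hd he
  have hQ : ∀ e, G.Leaving e → ¬ (e = Y.inv (ℓ' (a - 1)) ∨ e = ℓ' b) → e ∉ hℓ'.graph.edges :=
    fun e he hn hh => hn (hℓ'.eq_of_leaving_seg (hseg ▸ he) hh)
  have hmono : Y.regularSphere G.carrier \ hℓ'.graph.carrier ⊆ hℓ'.graph.carrierᶜ := fun _ h => h.2
  have hconn := fun {d d'} hd hd' hdx hdy hdx' hdy' =>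
    hcut.sphereConn_pair hz hp hq (hℓ'.ne_inv _ _).symm (hne hxM' hpM) (hne hxM' hqM) (hne hyM' hpM)
      (hne hyM' hqM) (hne hzM' hpM) (hne hzM' hqM)
      (fun hh => hxy (hh.linked hx hxM' hQ))
      (fun hh => hwz (hwx.trans ((hh.linked hx hxM' hQ).mono hmono)))
      (fun hh => hwz (hwy.trans ((hh.linked hy hyM' hQ).mono hmono)))
      (d := d) (d' := d') hd hd' hdx hdy hdx' hdy'
  -- hence `ℓ` does not separate
  have hxy' : x ≠ y := by
    rintro rfl
    exact hxy (Linked.refl ⟨hxS, hxL'⟩)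
  have hQ' : ∀ e, G.Leaving e → ¬ (e = x ∨ e = y) → e ∉ hℓ.graph.edges := by
    intro e he hn hh
    have h1 := hℓ.eq_of_leaving_seg he hh
    have h2 := hℓ.eq_of_leaving_seg hx hxM
    have h3 := hℓ.eq_of_leaving_seg hy hyM
    rcases h1 with h1 | h1 <;> rcases h2 with h2 | h2 <;> rcases h3 with h3 | h3 <;>
      first
      | exact hxy' (h2.trans h3.symm)
      | exact hn (.inl (h1.trans h2.symm))
      | exact hn (.inr (h1.trans h3.symm))
  obtain ⟨u, v, hu, hv, huv⟩ := separatesIn_univ_iff.1 hsep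
  obtain ⟨d, hdv, hdM, hud⟩ := hℓ.exists_linked hc hY hu a
  obtain ⟨e, hev, heM, hve⟩ := hℓ.exists_linked hc hY hv a
  have hleave : ∀ {d}, Y.src d = Y.src (ℓ a) → d ∉ hℓ.graph.edges → G.Leaving d := fun h h' =>
    ⟨h ▸ hℓ.mem_seg_verts.2 ⟨le_rfl, hab⟩, fun hh => h' (hedges ▸ hh).1⟩
  have hne' : ∀ {d e}, d ∉ hℓ.graph.edges → e ∈ hℓ.graph.edges → d ≠ e := by
    rintro d _ hd he rfl
    exact hd he
  have hde := (hconn (hleave hdv hdM) (hleave hev heM) (hne' hdM hxM) (hne' hdM hyM) (hne' heM hxM)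
    (hne' heM hyM)).linked (hleave hdv hdM) hdM hQ'
  exact huv ((hud.trans (hde.mono fun _ h => h.2)).trans hve.symm)

end IsStraightLine

end VHComplex

open VHComplex in
theorem mainTheorem8 (T : TubularGraphOfGraphs) (hT : T.realization.IsBradyMeier)
    (Y : VHComplex) (p : Y.Hom T.realization) (hp : p.IsUniversalCover)
    (L L' : Set Y.Realization)
    (hL : Y.IsCombinatorialLine L) (hL' : Y.IsCombinatorialLine L')
    (hLsep : SeparatesIn Set.univ L Set.univ) (hL'sep : SeparatesIn Set.univ L' Set.univ) :
    Crosses L L' ↔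
      ((L ∩ L').Nonempty ∧ IsCompact (L ∩ L')) ∧
        SeparatesIn (Y.regularSphere (L ∩ L'))
          (L' ∩ Y.regularSphere (L ∩ L')) (L ∩ Y.regularSphere (L ∩ L')) := by
  have hcf := hp.1.cornersFaithful T.cornersFaithful
  have hY := hp.1.linksNoCut hT
  have hsc := hp.2
  have hc := hsc.1
  obtain ⟨ℓ, hℓ, rfl, hdist⟩ := hL.exists_isStraightLine
  obtain ⟨ℓ', hℓ', rfl, -⟩ := hL'.exists_isStraightLine
  have hord := hℓ'.ordConnected_preimage hcf hsc hℓ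
  constructor
  · intro hcr
    obtain ⟨⟨t₀, ht₀⟩, ⟨c, hcb⟩, ⟨C, hCa⟩⟩ :=
      IsStraightLine.bounded_of_crosses hc hY hℓ hℓ' hL'sep hord hcr
    have hvert : ∀ {n : ℤ}, Y.src (ℓ n) ∈ hℓ'.graph.verts → Y.linePt ℓ n ∈ hℓ'.graph.carrier :=
      fun h => by rw [linePt_intCast]; exact hℓ'.graph.vertexPt_mem_carrier.2 h
    obtain ⟨a, b, hab, hiff, m, hm, hg, hseg, hsrc, hedges, hcar⟩ := hℓ'.exists_seg hcf hsc hℓ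
      ⟨_, (hℓ'.exists_verts_of_linePt_mem ht₀ hℓ).1⟩
      ⟨⌊c⌋, fun n hn => Int.floor_le_iff.2 ((hcb (hvert hn)).trans_lt (lt_add_one _))⟩
      ⟨⌈C⌉, fun n hn => Int.le_ceil_iff.2 ((sub_one_lt _).trans_le (hCa (hvert hn)))⟩
    have hmem : ∀ t : ℝ, (a : ℝ) ≤ t → t ≤ b → Y.linePt ℓ t ∈ hℓ'.graph.carrier := fun t h h' =>
      hℓ'.linePt_mem_of_between hcf hsc ((hiff a).2 ⟨le_rfl, hab⟩) ((hiff b).2 ⟨hab, le_rfl⟩) h h' hℓ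
    have hmem' : ∀ t : ℝ, Y.linePt ℓ t ∈ hℓ'.graph.carrier → (a : ℝ) ≤ t ∧ t ≤ b := by
      intro t ht
      obtain ⟨h1, j, htj, hj⟩ := hℓ'.exists_verts_of_linePt_mem ht hℓ
      have h2 : (a : ℝ) ≤ ⌊t⌋ := by exact_mod_cast ((hiff _).1 h1).1
      have h3 : (j : ℝ) ≤ b := by exact_mod_cast ((hiff _).1 hj).2
      exact ⟨h2.trans (Int.floor_le t), htj.trans h3⟩
    have himage : hℓ.graph.carrier ∩ hℓ'.graph.carrier = Y.linePt ℓ '' Set.Icc (a : ℝ) b := by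
      ext x
      constructor
      · rintro ⟨hx, hx'⟩
        rw [← hℓ.range_linePt] at hx
        obtain ⟨t, rfl⟩ := hx
        exact ⟨t, hmem' t hx', rfl⟩
      · rintro ⟨t, ht, rfl⟩
        exact ⟨hℓ.range_linePt ▸ ⟨t, rfl⟩, hmem t ht.1 ht.2⟩
    refine ⟨⟨⟨_, hℓ.range_linePt ▸ ⟨t₀, rfl⟩, ht₀⟩, ?_⟩, ?_⟩
    · rw [himage]
      exact isCompact_Icc.image hℓ.continuous_linePt
    · rw [hg] at hcar hedges
      rw [← hcar]
      exact IsStraightLine.separatesIn_of_crosses hc hY hℓ hℓ' hab hedges hmem hmem' hcr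
  · rintro ⟨⟨⟨x, hx, hx'⟩, hcomp⟩, h⟩
    obtain ⟨C, hC⟩ := bounded_of_isCompact hdist hcomp
    have hvert : ∀ {n : ℤ}, Y.src (ℓ n) ∈ hℓ'.graph.verts → -C ≤ n ∧ n ≤ C := fun {n} hn =>
      hC n ⟨hℓ.graph.vertexPt_mem_carrier.2 (hℓ.mem_verts n), hℓ'.graph.vertexPt_mem_carrier.2 hn⟩
    rw [← hℓ.range_linePt] at hx
    obtain ⟨t, rfl⟩ := hx
    obtain ⟨a, b, hab, -, m, hm, hg, hseg, hsrc, hedges, hcar⟩ := hℓ'.exists_seg hcf hsc hℓ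
      ⟨_, (hℓ'.exists_verts_of_linePt_mem hx' hℓ).1⟩ ⟨-C, fun n hn => (hvert hn).1⟩
      ⟨C, fun n hn => (hvert hn).2⟩
    rw [← hg] at hL'sep h ⊢
    rw [← hcar] at h
    exact IsStraightLine.crosses_of_separatesIn hc hY hℓ hm hab hseg hsrc hedges hLsep hL'sep h
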